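/- Let $A\to M$ be a smooth vector bundle over a smooth manifold, with a Lie algebroid structure $([\cdot,\cdot],\rho)$ and differential $d$ on $\Omega(A)=\Gamma(\bigwedge^\bullet A^*)$. Let $C^\infty(T^*\Pi A)$ be the algebra of functions, polynomial in the fibre coordinates, on the cotangent bundle of the supermanifold $\Pi A$ (whose functions are $\Omega(A)$), with its canonical Poisson bracket, the big bracket $\{\cdot,\cdot\}$. Let $\mu\in C^\infty(T^*\Pi A)$ be the function of bidegree $(1,2)$ with $\{\mu,\mu\}=0$ and $\{\mu,\cdot\}=d$ on $\Omega(A)$. Multivectors, forms and $(1,1)$-tensors are regarded as elements of $C^\infty(T^*\Pi A)$, with $\{\alpha,\pi\}=\pi^\sharp\alpha$, $\{X,\omega\}=\omega^\flat X$, $\{X,N\}=NX$ for $X\in\Gamma(A)$, $\alpha\in\Gamma(A^*)$. For $\tau$ a bivector or a $2$-form put $e^{\tau}P=\sum_{k\ge 0}\frac1{k!}\{\dots\{\{P,\tau\},\tau\},\dots,\tau\}$ ($k$ brackets). Let $\pi\in\Gamma(\bigwedge^2A)$ be a Poisson bivector, $[\pi,\pi]_{SN}=0$, and let $\omega\in\Gamma(\bigwedge^2A^*)$.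 Put $\pi^\sharp(\alpha)=\pi(\alpha,\cdot)$, $\omega^\flat(X)=\omega(X,\cdot)$, $N=\pi^\sharp\circ\omega^\flat$, $\omega_N=\omega(N\cdot,\cdot)$, $\psi=d\omega_N$, $H=-d\omega$. Let $\mu_\pi$ be the function of bidegree $(2,1)$ corresponding to the Lie algebroid structure on $A^*$ with anchor $\rho\circ\pi^\sharp$ and bracket $$[\alpha,\beta]_\pi=\mathcal L_{\pi^\sharp\alpha}\beta-\mathcal L_{\pi^\sharp\beta}\alpha-d(\pi(\alpha,\beta)),$$ that is, $\{\{\mu_\pi,\alpha\},\beta\}=[\alpha,\beta]_\pi$ and $\{\{\mu_\pi,\alpha\},f\}=\rho(\pi^\sharp\alpha)f$. Let $$S=\{\pi+N,\mu+H\}+\psi$$ be the Lie quasi-bialgebroid structure on $(A^*,A)$ induced by $(\pi,N,d\omega_N,-d\omega)$. Then $\mu_\pi$ exists and is unique, $\{\mu_\pi,\mu_\pi\}=0$, and $\{S,S\}=0$. Moreover $S=\mu_\pi+d_N^H+(\psi+i_NH)$, where $d_N^H$ is the unique derivation of degree one of $\Omega(A)$ with $d_N^Hf=d_Nf$ and $d_N^H\alpha=d_N\alpha+i_{\pi^\sharp\alpha}H$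 for $f\in C^\infty(M)$, $\alpha\in\Gamma(A^*)$, with $d_N=i_N d-d\,i_N$. The series below are finite sums, and $$S=e^{-\omega}\bigl(e^{-\pi}\mu-\mu\bigr),\qquad e^{-\pi}\mu-\mu=\mu_\pi,\qquad S=e^{-\omega}(\mu_\pi).$$ -/

import Mathlib

set_option linter.unusedSectionVars false
set_option linter.unusedVariables false
set_option linter.unusedSimpArgs false

namespace SuperCotangent

section Super
variable {Ω : Type*} [Ring Ω] [Algebra ℝ Ω] (σ : Ω →ₐ[ℝ] Ω)

/-- Even part of `f`, where `σ` is the parity involution `f ↦ (-1)^|f| f`. -/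
noncomputable def evenPart (f : Ω) : Ω := (2⁻¹ : ℝ) • (f + σ f)

/-- Odd part of `f`. -/
noncomputable def oddPart (f : Ω) : Ω := (2⁻¹ : ℝ) • (f - σ f)

/-- Contraction in the first argument; for a function `P` on the cotangent space this is `{P, f}`. -/
def contr (P : List Ω → Ω) (f : Ω) : List Ω → Ω := fun l => P (f :: l)

/-- The parity involution `P ↦ (-1)^|P| P` on families of maps. -/
def parity (P : List Ω → Ω) : List Ω → Ω := fun l => σ (P (l.map σ))

/-- The canonical (even) Poisson bracket in terms of families of maps: it is determined by
`{P, Q}|₀ = {P₁, Q₀} + {P₀, Q₁}` on the zero section (empty list), where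
`{P₀, Q₁} = -(-1)^(|P| |Q|) Q₁(P₀)`, and by the graded Jacobi identity
`{{P, Q}, f} = {P, {Q, f}} + (-1)^(|Q| |f|) {{P, f}, Q}`. -/
noncomputable def rawBracket : (List Ω → Ω) → (List Ω → Ω) → List Ω → Ω
  | P, Q, [] => P [Q []] - (Q [evenPart σ (P [])] + parity σ Q [oddPart σ (P [])])
  | P, Q, f :: l =>
      rawBracket P (contr Q f) l + rawBracket (contr P (evenPart σ f)) Q l
        + rawBracket (contr P (oddPart σ f)) (parity σ Q) l

/-- Let `Ω` be the superalgebra of functions on a supermanifold `X`. A function `P` on `T^*X` that is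
polynomial in the fibre coordinates (momenta) of `T^*X → X` is the same as a finite family of graded
symmetric multiderivations of `Ω`: the list `[f₁, …, fₖ]` is sent to the restriction of
`{…{{P, f₁}, f₂}, …, fₖ}` to the zero section, and only the part of `P` of degree `k` in the momenta
contributes to it. The conditions are: multilinearity, graded symmetry, the graded Leibniz
rule `{Y, f g} = {Y, f} g + (-1)^(|Y| |f|) f {Y, g}`, and polynomiality. -/
structure IsFunction (P : List Ω → Ω) : Prop where
  map_add : ∀ (l l' : List Ω) (f g : Ω),
    P (l ++ (f + g) :: l') = P (l ++ f :: l') + P (l ++ g :: l')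
  map_smul : ∀ (l l' : List Ω) (c : ℝ) (f : Ω), P (l ++ (c • f) :: l') = c • P (l ++ f :: l')
  symm_even : ∀ (l l' : List Ω) (f g : Ω), σ f = f →
    P (l ++ f :: g :: l') = P (l ++ g :: f :: l')
  symm_odd : ∀ (l l' : List Ω) (f g : Ω), σ f = -f → σ g = -g →
    P (l ++ f :: g :: l') = -P (l ++ g :: f :: l')
  leibniz : ∀ (l : List Ω) (f g : Ω),
    P (l ++ [f * g]) = P (l ++ [f]) * g + evenPart σ f * P (l ++ [g])
      + oddPart σ f * σ (P (l ++ [σ g]))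
  polynomial : ∃ n : ℕ, ∀ l : List Ω, n ≤ l.length → P l = 0

variable {σ}

theorem IsFunction.contr {P : List Ω → Ω} (hP : IsFunction σ P) (f : Ω) :
    IsFunction σ (contr P f) where
  map_add l l' := hP.map_add (f :: l) l'
  map_smul l l' := hP.map_smul (f :: l) l'
  symm_even l l' := hP.symm_even (f :: l) l'
  symm_odd l l' := hP.symm_odd (f :: l) l'
  leibniz l := hP.leibniz (f :: l)
  polynomial := by
    obtain ⟨n, hn⟩ := hP.polynomial
    exact ⟨n, fun l hl => hn _ (by simp; omega)⟩

theorem IsFunction.parity {P : List Ω → Ω} (hP : IsFunction σ P) (hσ : ∀ f, σ (σ f) = f) :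
    IsFunction σ (parity σ P) where
  map_add l l' f g := by simp [SuperCotangent.parity, hP.map_add]
  map_smul l l' c f := by simp [SuperCotangent.parity, hP.map_smul]
  symm_even l l' f g h := by
    simp only [SuperCotangent.parity, List.map_append, List.map_cons]
    rw [hP.symm_even _ _ _ _ (by rw [hσ, h])]
  symm_odd l l' f g hf hg := by
    simp only [SuperCotangent.parity, List.map_append, List.map_cons]
    rw [hP.symm_odd _ _ _ _ (by rw [hσ, hf, neg_neg]) (by rw [hσ, hg, neg_neg]), _root_.map_neg]
  leibniz l f g := by
    simp only [SuperCotangent.parity, List.map_append, List.map_cons, List.map_nil, _root_.map_mul]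
    rw [hP.leibniz]
    simp [evenPart, oddPart, hσ, add_comm]
  polynomial := by
    obtain ⟨n, hn⟩ := hP.polynomial
    exact ⟨n, fun l hl => by simp [SuperCotangent.parity, hn (l.map σ) (by simpa using hl)]⟩

theorem IsFunction.zero : IsFunction σ (0 : List Ω → Ω) where
  map_add _ _ _ _ := by simp
  map_smul _ _ _ _ := by simp
  symm_even _ _ _ _ _ := rfl
  symm_odd _ _ _ _ _ _ := by simp
  leibniz _ _ _ := by simp
  polynomial := ⟨0, fun _ _ => rfl⟩

theorem IsFunction.add {P Q : List Ω → Ω} (hP : IsFunction σ P) (hQ : IsFunction σ Q) :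
    IsFunction σ (P + Q) where
  map_add l l' f g := by simp only [Pi.add_apply, hP.map_add, hQ.map_add]; abel
  map_smul l l' c f := by simp only [Pi.add_apply, hP.map_smul, hQ.map_smul, smul_add]
  symm_even l l' f g h := by
    simp only [Pi.add_apply, hP.symm_even l l' f g h, hQ.symm_even l l' f g h]
  symm_odd l l' f g h h' := by
    simp only [Pi.add_apply, hP.symm_odd l l' f g h h', hQ.symm_odd l l' f g h h', neg_add]
  leibniz l f g := by
    simp only [Pi.add_apply, hP.leibniz, hQ.leibniz, _root_.map_add, mul_add, add_mul]; abel
  polynomial := by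
    obtain ⟨m, hm⟩ := hP.polynomial
    obtain ⟨n, hn⟩ := hQ.polynomial
    exact ⟨m + n, fun l hl => by
      rw [Pi.add_apply, hm l (by omega), hn l (by omega), add_zero]⟩

theorem IsFunction.smul (c : ℝ) {P : List Ω → Ω} (hP : IsFunction σ P) :
    IsFunction σ (c • P) where
  map_add l l' f g := by simp only [Pi.smul_apply, hP.map_add, smul_add]
  map_smul l l' a f := by simp only [Pi.smul_apply, hP.map_smul, smul_comm c a]
  symm_even l l' f g h := by simp only [Pi.smul_apply, hP.symm_even l l' f g h]
  symm_odd l l' f g h h' := by simp only [Pi.smul_apply, hP.symm_odd l l' f g h h', smul_neg]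
  leibniz l f g := by
    simp only [Pi.smul_apply, hP.leibniz, _root_.map_smul, smul_add, smul_mul_assoc,
      mul_smul_comm]
  polynomial := by
    obtain ⟨n, hn⟩ := hP.polynomial
    exact ⟨n, fun l hl => by rw [Pi.smul_apply, hn l hl, smul_zero]⟩

theorem IsFunction.contr_add {P : List Ω → Ω} (hP : IsFunction σ P) (f g : Ω) :
    SuperCotangent.contr P (f + g) = SuperCotangent.contr P f + SuperCotangent.contr P g :=
  funext fun l => hP.map_add [] l f g

theorem IsFunction.contr_smul {P : List Ω → Ω} (hP : IsFunction σ P) (c : ℝ) (f : Ω) :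
    SuperCotangent.contr P (c • f) = c • SuperCotangent.contr P f :=
  funext fun l => hP.map_smul [] l c f

theorem IsFunction.contr_zero {P : List Ω → Ω} (hP : IsFunction σ P) :
    SuperCotangent.contr P 0 = 0 := by
  simpa using hP.contr_smul 0 0

theorem IsFunction.contr_neg {P : List Ω → Ω} (hP : IsFunction σ P) (f : Ω) :
    SuperCotangent.contr P (-f) = -SuperCotangent.contr P f := by
  simpa using hP.contr_smul (-1) f

theorem contr_zero_left (f : Ω) : SuperCotangent.contr (0 : List Ω → Ω) f = 0 := rfl

theorem evenPart_add (f g : Ω) : evenPart σ (f + g) = evenPart σ f + evenPart σ g := by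
  simp only [evenPart, map_add]; module

theorem oddPart_add (f g : Ω) : oddPart σ (f + g) = oddPart σ f + oddPart σ g := by
  simp only [oddPart, map_add]; module

theorem evenPart_smul (c : ℝ) (f : Ω) : evenPart σ (c • f) = c • evenPart σ f := by
  simp only [evenPart, map_smul]; module

theorem oddPart_smul (c : ℝ) (f : Ω) : oddPart σ (c • f) = c • oddPart σ f := by
  simp only [oddPart, map_smul]; module

theorem evenPart_add_oddPart (f : Ω) : evenPart σ f + oddPart σ f = f := by
  simp only [evenPart, oddPart]; module

theorem apply_evenPart (hσ : ∀ f, σ (σ f) = f) (f : Ω) : σ (evenPart σ f) = evenPart σ f := by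
  simp only [evenPart, map_smul, map_add, hσ, add_comm]

theorem apply_oddPart (hσ : ∀ f, σ (σ f) = f) (f : Ω) : σ (oddPart σ f) = -oddPart σ f := by
  simp only [oddPart, map_smul, map_sub, hσ]; module

theorem evenPart_of_even {f : Ω} (h : σ f = f) : evenPart σ f = f := by
  rw [evenPart, h]; module

theorem oddPart_of_even {f : Ω} (h : σ f = f) : oddPart σ f = 0 := by
  rw [oddPart, h]; module

theorem evenPart_of_odd {f : Ω} (h : σ f = -f) : evenPart σ f = 0 := by
  rw [evenPart, h]; module

theorem oddPart_of_odd {f : Ω} (h : σ f = -f) : oddPart σ f = f := by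
  rw [oddPart, h]; module

theorem parity_add (P Q : List Ω → Ω) : parity σ (P + Q) = parity σ P + parity σ Q := by
  funext l; simp [parity]

theorem parity_smul (c : ℝ) (P : List Ω → Ω) : parity σ (c • P) = c • parity σ P := by
  funext l; simp [parity]

theorem parity_parity (hσ : ∀ f, σ (σ f) = f) (P : List Ω → Ω) :
    parity σ (parity σ P) = P := by
  have : (σ : Ω → Ω) ∘ σ = id := funext hσ
  funext l; simp [parity, hσ, this]

theorem contr_parity (hσ : ∀ f, σ (σ f) = f) (P : List Ω → Ω) (f : Ω) :
    contr (parity σ P) f = parity σ (contr P (σ f)) := by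
  funext l; simp [parity, contr]

theorem rawBracket_add_left (hσ : ∀ f, σ (σ f) = f) (l : List Ω) :
    ∀ {P P' Q : List Ω → Ω}, IsFunction σ Q →
      rawBracket σ (P + P') Q l = rawBracket σ P Q l + rawBracket σ P' Q l := by
  induction l with
  | nil =>
    intro P P' Q hQ
    have h1 := hQ.map_add [] []
    have h2 := (hQ.parity hσ).map_add [] []
    simp only [List.nil_append] at h1 h2
    simp only [rawBracket, Pi.add_apply, evenPart_add, oddPart_add, h1, h2]
    abel
  | cons f l ih =>
    intro P P' Q hQ
    have h : ∀ g, contr (P + P') g = contr P g + contr P' g := fun _ => rfl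
    simp only [rawBracket, h, ih hQ, ih (hQ.contr f), ih (hQ.parity hσ)]
    abel

theorem rawBracket_add_right (l : List Ω) :
    ∀ {P Q Q' : List Ω → Ω}, IsFunction σ P →
      rawBracket σ P (Q + Q') l = rawBracket σ P Q l + rawBracket σ P Q' l := by
  induction l with
  | nil =>
    intro P Q Q' hP
    have h1 := hP.map_add [] []
    simp only [List.nil_append] at h1
    simp only [rawBracket, Pi.add_apply, parity_add, h1]
    abel
  | cons f l ih =>
    intro P Q Q' hP
    have h : contr (Q + Q') f = contr Q f + contr Q' f := rfl
    simp only [rawBracket, h, ih hP, ih (hP.contr _), parity_add]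
    abel

theorem rawBracket_smul_left (hσ : ∀ f, σ (σ f) = f) (c : ℝ) (l : List Ω) :
    ∀ {P Q : List Ω → Ω}, IsFunction σ Q →
      rawBracket σ (c • P) Q l = c • rawBracket σ P Q l := by
  induction l with
  | nil =>
    intro P Q hQ
    have h1 := hQ.map_smul [] []
    have h2 := (hQ.parity hσ).map_smul [] []
    simp only [List.nil_append] at h1 h2
    simp only [rawBracket, Pi.smul_apply, evenPart_smul, oddPart_smul, h1, h2]
    module
  | cons f l ih =>
    intro P Q hQ
    have h : ∀ g, contr (c • P) g = c • contr P g := fun _ => rfl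
    simp only [rawBracket, h, ih hQ, ih (hQ.contr f), ih (hQ.parity hσ)]
    module

theorem rawBracket_smul_right (c : ℝ) (l : List Ω) :
    ∀ {P Q : List Ω → Ω}, IsFunction σ P →
      rawBracket σ P (c • Q) l = c • rawBracket σ P Q l := by
  induction l with
  | nil =>
    intro P Q hP
    have h1 := hP.map_smul [] []
    simp only [List.nil_append] at h1
    simp only [rawBracket, Pi.smul_apply, parity_smul, h1]
    module
  | cons f l ih =>
    intro P Q hP
    have h : contr (c • Q) f = c • contr Q f := rfl
    simp only [rawBracket, h, ih hP, ih (hP.contr _), parity_smul]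
    module

theorem rawBracket_zero_left (hσ : ∀ f, σ (σ f) = f) {Q : List Ω → Ω} (hQ : IsFunction σ Q)
    (l : List Ω) : rawBracket σ 0 Q l = 0 := by
  simpa using rawBracket_smul_left hσ 0 l (P := 0) hQ

theorem rawBracket_neg_right {P Q : List Ω → Ω} (hP : IsFunction σ P)
    (l : List Ω) : rawBracket σ P (-Q) l = -rawBracket σ P Q l := by
  simpa using rawBracket_smul_right (-1) l (Q := Q) hP

theorem rawBracket_neg_left (hσ : ∀ f, σ (σ f) = f) {P Q : List Ω → Ω} (hQ : IsFunction σ Q)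
    (l : List Ω) : rawBracket σ (-P) Q l = -rawBracket σ P Q l := by
  simpa using rawBracket_smul_left hσ (-1) l (P := P) hQ

theorem parity_rawBracket (hσ : ∀ f, σ (σ f) = f) (l : List Ω) :
    ∀ {P Q : List Ω → Ω}, IsFunction σ P → IsFunction σ Q →
      parity σ (rawBracket σ P Q) l = rawBracket σ (parity σ P) (parity σ Q) l := by
  have e1 : ∀ f, evenPart σ (σ f) = evenPart σ f := fun f => by
    simp only [evenPart, hσ, add_comm]
  have e2 : ∀ f, σ (evenPart σ f) = evenPart σ f := apply_evenPart hσ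
  have e3 : ∀ f, oddPart σ (σ f) = -oddPart σ f := fun f => by
    simp only [oddPart, hσ]; module
  have e4 : ∀ f, σ (oddPart σ f) = -oddPart σ f := apply_oddPart hσ
  induction l with
  | nil =>
    intro P Q hP hQ
    simp [parity, rawBracket, e1, e2, e3, e4, hσ]
  | cons f l ih =>
    intro P Q hP hQ
    have ih' : ∀ {P Q : List Ω → Ω}, IsFunction σ P → IsFunction σ Q →
        σ (rawBracket σ P Q (l.map σ)) = rawBracket σ (parity σ P) (parity σ Q) l := ih
    have h2 := contr_parity hσ P (evenPart σ f)
    have h3 := contr_parity hσ P (oddPart σ f)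
    rw [e2] at h2
    rw [e4] at h3
    rw [rawBracket, contr_parity hσ, h2, h3]
    simp only [parity, List.map_cons]
    rw [rawBracket, map_add, map_add, ih' hP (hQ.contr _), ih' (hP.contr _) hQ,
      ih' (hP.contr _) (hQ.parity hσ), e1, e3]

theorem rawBracket_map_add (hσ : ∀ f, σ (σ f) = f) (l l' : List Ω) (f g : Ω) :
    ∀ {P Q : List Ω → Ω}, IsFunction σ P → IsFunction σ Q →
      rawBracket σ P Q (l ++ (f + g) :: l')
        = rawBracket σ P Q (l ++ f :: l') + rawBracket σ P Q (l ++ g :: l') := by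
  induction l with
  | nil =>
    intro P Q hP hQ
    simp only [List.nil_append, rawBracket, evenPart_add, oddPart_add, hP.contr_add, hQ.contr_add,
      rawBracket_add_right l' hP, rawBracket_add_left hσ l' hQ,
      rawBracket_add_left hσ l' (hQ.parity hσ)]
    abel
  | cons a l ih =>
    intro P Q hP hQ
    simp only [List.cons_append, rawBracket, ih hP (hQ.contr _), ih (hP.contr _) hQ,
      ih (hP.contr _) (hQ.parity hσ)]
    abel

theorem rawBracket_map_smul (hσ : ∀ f, σ (σ f) = f) (l l' : List Ω) (c : ℝ) (f : Ω) :
    ∀ {P Q : List Ω → Ω}, IsFunction σ P → IsFunction σ Q →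
      rawBracket σ P Q (l ++ (c • f) :: l') = c • rawBracket σ P Q (l ++ f :: l') := by
  induction l with
  | nil =>
    intro P Q hP hQ
    simp only [List.nil_append, rawBracket, evenPart_smul, oddPart_smul, hP.contr_smul,
      hQ.contr_smul, rawBracket_smul_right c l' hP, rawBracket_smul_left hσ c l' hQ,
      rawBracket_smul_left hσ c l' (hQ.parity hσ)]
    module
  | cons a l ih =>
    intro P Q hP hQ
    simp only [List.cons_append, rawBracket, ih hP (hQ.contr _), ih (hP.contr _) hQ,
      ih (hP.contr _) (hQ.parity hσ)]
    module

theorem rawBracket_symm_even (hσ : ∀ f, σ (σ f) = f) (l l' : List Ω) (f g : Ω) (hf : σ f = f) :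
    ∀ {P Q : List Ω → Ω}, IsFunction σ P → IsFunction σ Q →
      rawBracket σ P Q (l ++ f :: g :: l') = rawBracket σ P Q (l ++ g :: f :: l') := by
  induction l with
  | nil =>
    intro P Q hP hQ
    have hs : ∀ {P : List Ω → Ω}, IsFunction σ P → ∀ g,
        contr (contr P g) f = contr (contr P f) g := fun {P} hP g => by
      funext l
      exact (hP.symm_even [] l f g hf).symm
    have hz : ∀ {P : List Ω → Ω}, IsFunction σ P → contr P 0 = 0 := fun hP => hP.contr_zero
    simp only [List.nil_append, rawBracket, evenPart_of_even hf, oddPart_of_even hf,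
      hz hP, hz (hP.contr _), contr_zero_left, rawBracket_zero_left hσ hQ, contr_parity hσ, hf, hs hP, hs hQ,
      rawBracket_zero_left hσ (hQ.parity hσ), rawBracket_zero_left hσ (hQ.contr _),
      rawBracket_zero_left hσ ((hQ.parity hσ).parity hσ),
      rawBracket_zero_left hσ ((hQ.contr _).parity hσ)]
    abel
  | cons a l ih =>
    intro P Q hP hQ
    simp only [List.cons_append, rawBracket, ih hP (hQ.contr _), ih (hP.contr _) hQ,
      ih (hP.contr _) (hQ.parity hσ)]

theorem rawBracket_symm_odd (hσ : ∀ f, σ (σ f) = f) (l l' : List Ω) (f g : Ω) (hf : σ f = -f)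
    (hg : σ g = -g) :
    ∀ {P Q : List Ω → Ω}, IsFunction σ P → IsFunction σ Q →
      rawBracket σ P Q (l ++ f :: g :: l') = -rawBracket σ P Q (l ++ g :: f :: l') := by
  induction l with
  | nil =>
    intro P Q hP hQ
    have hs : ∀ {P : List Ω → Ω}, IsFunction σ P →
        contr (contr P g) f = -contr (contr P f) g := fun {P} hP => by
      funext l
      exact (hP.symm_odd [] l g f hg hf)
    have hz : ∀ {P : List Ω → Ω}, IsFunction σ P → contr P 0 = 0 := fun hP => hP.contr_zero
    have hn : ∀ P : List Ω → Ω, parity σ (-P) = -parity σ P := fun P => by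
      funext l; simp [parity]
    simp only [List.nil_append, rawBracket, evenPart_of_odd hf, oddPart_of_odd hf,
      evenPart_of_odd hg, oddPart_of_odd hg,
      hz hP, hz (hP.contr _), contr_zero_left, rawBracket_zero_left hσ hQ, contr_parity hσ, hf, hg, hs hP, hs hQ,
      hQ.contr_neg, hn, rawBracket_neg_right hP, rawBracket_neg_right (hP.contr _),
      parity_parity hσ, rawBracket_neg_left hσ hQ,
      rawBracket_zero_left hσ (hQ.parity hσ), rawBracket_zero_left hσ (hQ.contr _)]
    abel
  | cons a l ih =>
    intro P Q hP hQ
    simp only [List.cons_append, rawBracket, ih hP (hQ.contr _), ih (hP.contr _) hQ,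
      ih (hP.contr _) (hQ.parity hσ)]
    abel

theorem rawBracket_polynomial (hσ : ∀ f, σ (σ f) = f) (l : List Ω) :
    ∀ {P Q : List Ω → Ω} (m n : ℕ), IsFunction σ P → IsFunction σ Q →
      (∀ f : List Ω, m ≤ f.length → P f = 0) → (∀ f : List Ω, n ≤ f.length → Q f = 0) →
      m + n ≤ l.length → rawBracket σ P Q l = 0 := by
  induction l with
  | nil =>
    intro P Q m n hP hQ hm hn h
    have h' : m = 0 ∧ n = 0 := by simpa using h
    have hP' : P = 0 := funext fun g => hm g (by omega)
    have hQ' : Q = 0 := funext fun g => hn g (by omega)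
    simp [rawBracket, parity, hP', hQ']
  | cons f l ih =>
    intro P Q m n hP hQ hm hn h
    have hpar : ∀ g : List Ω, n ≤ g.length → parity σ Q g = 0 := fun g hg => by
      simp [parity, hn (g.map σ) (by simpa using hg)]
    rcases m with _ | m
    · have : P = 0 := funext fun g => hm g (Nat.zero_le _)
      rw [this, rawBracket_zero_left hσ hQ]
    rcases n with _ | n
    · have : Q = 0 := funext fun g => hn g (Nat.zero_le _)
      rw [this]
      simpa using rawBracket_smul_right 0 (f :: l) (Q := 0) hP
    have h1 : ∀ a, ∀ g : List Ω, m ≤ g.length → contr P a g = 0 := fun a g hg =>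
      hm _ (by simpa using hg)
    have h2 : ∀ a, ∀ g : List Ω, n ≤ g.length → contr Q a g = 0 := fun a g hg =>
      hn _ (by simpa using hg)
    simp only [List.length_cons] at h
    rw [rawBracket, ih (m + 1) n hP (hQ.contr f) hm (h2 f) (by omega),
      ih m (n + 1) (hP.contr _) hQ (h1 _) hn (by omega),
      ih m (n + 1) (hP.contr _) (hQ.parity hσ) (h1 _) hpar (by omega)]
    simp

theorem koszulSign_aux {s t : ℝ} (hs : s = 1 ∨ s = -1) (ht : t = 1 ∨ t = -1)
    {Q : List Ω → Ω} (hQ : IsFunction σ Q) (hQt : parity σ Q = t • Q) (l : List Ω) {c : Ω}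
    (hc : σ c = s • c) :
    Q (evenPart σ c :: l) + parity σ Q (oddPart σ c :: l)
      = ((2⁻¹ : ℝ) * (1 + s + t - s * t)) • Q (c :: l) := by
  have h0 := congrFun hQ.contr_zero l
  simp only [contr, Pi.zero_apply] at h0
  rw [hQt]
  rcases hs with rfl | rfl <;> rcases ht with rfl | rfl
  all_goals
    first
    | rw [one_smul] at hc
      rw [evenPart_of_even hc, oddPart_of_even hc, Pi.smul_apply, h0]
      norm_num
    | rw [neg_one_smul] at hc
      rw [evenPart_of_odd hc, oddPart_of_odd hc, Pi.smul_apply, h0]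
      norm_num

theorem parity_contr {t : ℝ} (hσ : ∀ f, σ (σ f) = f) {Q : List Ω → Ω} (hQ : IsFunction σ Q)
    (hQt : parity σ Q = t • Q) {u : ℝ} {c : Ω} (hc : σ c = u • c) :
    parity σ (contr Q c) = (t * u) • contr Q c := by
  have := contr_parity hσ Q (σ c)
  rw [hσ, hQt, hc, show contr (t • Q) (u • c) = t • contr Q (u • c) from rfl, hQ.contr_smul] at this
  rw [← this, smul_smul]

theorem rawBracket_leibniz_aux (hσ : ∀ f, σ (σ f) = f) {P Q : List Ω → Ω} {s t u : ℝ}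
    (hs : s = 1 ∨ s = -1) (ht : t = 1 ∨ t = -1) (hu : u = 1 ∨ u = -1)
    (hP : IsFunction σ P) (hQ : IsFunction σ Q) (hPs : parity σ P = s • P)
    (hQt : parity σ Q = t • Q) (f g : Ω) (hf : σ f = u • f) :
    rawBracket σ P Q [f * g] = rawBracket σ P Q [f] * g + evenPart σ f * rawBracket σ P Q [g]
      + oddPart σ f * σ (rawBracket σ P Q [σ g]) := by
  have pm : ∀ {a b : ℝ}, (a = 1 ∨ a = -1) → (b = 1 ∨ b = -1) → (a * b = 1 ∨ a * b = -1) := by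
    rintro a b (rfl | rfl) (rfl | rfl) <;> simp
  have base : ∀ {P Q : List Ω → Ω} {s t : ℝ}, (s = 1 ∨ s = -1) → (t = 1 ∨ t = -1) →
      IsFunction σ Q → parity σ P = s • P → parity σ Q = t • Q →
      rawBracket σ P Q [] = P [Q []] - ((2⁻¹ : ℝ) * (1 + s + t - s * t)) • Q [P []] := by
    intro P Q s t hs ht hQ hPs hQt
    have hc : σ (P []) = s • P [] := congrFun hPs []
    rw [rawBracket, koszulSign_aux hs ht hQ hQt [] hc]
  -- the bracket on one argument, for a homogeneous argument and then in general
  have key0 : ∀ (h : Ω) {u : ℝ}, (u = 1 ∨ u = -1) → σ h = u • h →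
      rawBracket σ P Q [h] = P [Q [h]] + P [Q [], h]
      - ((2⁻¹ : ℝ) * (1 + s + t - s * t)) • (Q [P [h]] + Q [P [], h]) := by
    intro h u hu hh
    have hQ0 : σ (Q []) = t • Q [] := congrFun hQt []
    have hP0 : σ (P []) = s • P [] := congrFun hPs []
    have b1 : rawBracket σ P (contr Q h) [] = P [Q [h]]
        - ((2⁻¹ : ℝ) * (1 + s + t * u - s * (t * u))) • Q [h, P []] :=
      base hs (pm ht hu) (hQ.contr h) hPs (parity_contr hσ hQ hQt hh)
    have b2 : rawBracket σ (contr P h) Q [] = P [h, Q []]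
        - ((2⁻¹ : ℝ) * (1 + s * u + t - s * u * t)) • Q [P [h]] :=
      base (pm hs hu) ht hQ (parity_contr hσ hP hPs hh) hQt
    rw [rawBracket, b1, hQt, rawBracket_smul_right t [] (hP.contr _)]
    have sw : ∀ {R : List Ω → Ω} {w : ℝ}, IsFunction σ R → (w = 1 ∨ w = -1) → ∀ c : Ω,
        σ c = w • c → R [c, h] = ((2⁻¹ : ℝ) * (1 + u + w - u * w)) • R [h, c] := by
      intro R w hR hw c hc
      rcases hu with rfl | rfl
      · rw [one_smul] at hh
        have := hR.symm_even [] [] h c hh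
        simp only [List.nil_append] at this
        rw [this]; norm_num
      · rw [neg_one_smul] at hh
        rcases hw with rfl | rfl
        · rw [one_smul] at hc
          have := hR.symm_even [] [] c h hc
          simp only [List.nil_append] at this
          rw [this]; norm_num
        · rw [neg_one_smul] at hc
          have := hR.symm_odd [] [] c h hc hh
          simp only [List.nil_append] at this
          rw [this]; norm_num
    rw [sw hP ht _ hQ0, sw hQ hs _ hP0]
    have z0 : rawBracket σ (contr P 0) Q [] = 0 := by
      rw [hP.contr_zero, rawBracket_zero_left hσ hQ]
    rcases hu with rfl | rfl
    · rw [one_smul] at hh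
      rw [evenPart_of_even hh, oddPart_of_even hh]
      rw [z0, b2]
      rcases hs with rfl | rfl <;> rcases ht with rfl | rfl <;> norm_num <;> abel
    · rw [neg_one_smul] at hh
      rw [evenPart_of_odd hh, oddPart_of_odd hh]
      rw [z0, b2]
      rcases hs with rfl | rfl <;> rcases ht with rfl | rfl <;> norm_num <;> abel
  have key : ∀ h : Ω, rawBracket σ P Q [h] = P [Q [h]] + P [Q [], h]
      - ((2⁻¹ : ℝ) * (1 + s + t - s * t)) • (Q [P [h]] + Q [P [], h]) := by
    intro h
    have k1 := key0 (evenPart σ h) (Or.inl rfl) (by rw [apply_evenPart hσ, one_smul])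
    have k2 := key0 (oddPart σ h) (Or.inr rfl) (by rw [apply_oddPart hσ, neg_one_smul])
    have a0 := rawBracket_map_add hσ [] [] (evenPart σ h) (oddPart σ h) hP hQ
    have a1 := hP.map_add [] [] (Q [evenPart σ h]) (Q [oddPart σ h])
    have a2 := hQ.map_add [] [] (P [evenPart σ h]) (P [oddPart σ h])
    have a3 := hP.map_add [Q []] [] (evenPart σ h) (oddPart σ h)
    have a4 := hQ.map_add [P []] [] (evenPart σ h) (oddPart σ h)
    have a5 := hP.map_add [] [] (evenPart σ h) (oddPart σ h)
    have a6 := hQ.map_add [] [] (evenPart σ h) (oddPart σ h)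
    simp only [List.nil_append, List.cons_append, evenPart_add_oddPart] at a0 a1 a2 a3 a4 a5 a6
    rw [a0, k1, k2, a3, a4, a5, a6, a1, a2]
    module
  have LX : ∀ {R : List Ω → Ω} {w v : ℝ} (l : List Ω), IsFunction σ R → (w = 1 ∨ w = -1) →
      (v = 1 ∨ v = -1) → (∀ h, σ (R (l ++ [σ h])) = w • R (l ++ [h])) → ∀ c g : Ω, σ c = v • c →
      R (l ++ [c * g]) = R (l ++ [c]) * g
        + ((2⁻¹ : ℝ) * (1 + w + v - w * v)) • (c * R (l ++ [g])) := by
    intro R w v l hR hw hv hh c g hc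
    rw [hR.leibniz, hh]
    rcases hv with rfl | rfl
    · rw [one_smul] at hc
      rw [evenPart_of_even hc, oddPart_of_even hc]
      rcases hw with rfl | rfl <;> norm_num
    · rw [neg_one_smul] at hc
      rw [evenPart_of_odd hc, oddPart_of_odd hc]
      rcases hw with rfl | rfl <;> norm_num
  have P1 : ∀ h, σ (P ([] ++ [σ h])) = s • P ([] ++ [h]) := fun h => congrFun hPs [h]
  have Q1 : ∀ h, σ (Q ([] ++ [σ h])) = t • Q ([] ++ [h]) := fun h => congrFun hQt [h]
  have P2 : ∀ h, σ (P ([Q []] ++ [σ h])) = (s * t) • P ([Q []] ++ [h]) := fun h =>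
    congrFun (parity_contr hσ hP hPs (congrFun hQt [])) [h]
  have Q2 : ∀ h, σ (Q ([P []] ++ [σ h])) = (t * s) • Q ([P []] ++ [h]) := fun h =>
    congrFun (parity_contr hσ hQ hQt (congrFun hPs [])) [h]
  have hPf : σ (P [f]) = (s * u) • P [f] := congrFun (parity_contr hσ hP hPs hf) []
  have hQf : σ (Q [f]) = (t * u) • Q [f] := congrFun (parity_contr hσ hQ hQt hf) []
  have hR : σ (rawBracket σ P Q [σ g]) = (s * t) • rawBracket σ P Q [g] := by
    have := parity_rawBracket hσ [g] hP hQ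
    have h3 : IsFunction σ (t • Q) := hQt ▸ hQ.parity hσ
    rw [hPs, hQt, rawBracket_smul_left hσ s _ h3, rawBracket_smul_right t _ hP, smul_smul] at this
    exact this
  have e1 := LX [] hP hs (pm ht hu) P1 (Q [f]) g hQf
  have e2 := LX [] hQ ht (pm hs hu) Q1 (P [f]) g hPf
  have e3 := LX [] hP hs hu P1 f g hf
  have e4 := LX [] hQ ht hu Q1 f g hf
  have e5 := LX [Q []] hP (pm hs ht) hu P2 f g hf
  have e6 := LX [P []] hQ (pm ht hs) hu Q2 f g hf
  have e7 := LX [] hP hs hu P1 f (Q [g]) hf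
  have e8 := LX [] hQ ht hu Q1 f (P [g]) hf
  have a1 := hP.map_add [] [] (Q [f] * g)
    (((2⁻¹ : ℝ) * (1 + t + u - t * u)) • (f * Q [g]))
  have a2 := hQ.map_add [] [] (P [f] * g)
    (((2⁻¹ : ℝ) * (1 + s + u - s * u)) • (f * P [g]))
  have a3 := hP.map_smul [] [] ((2⁻¹ : ℝ) * (1 + t + u - t * u)) (f * Q [g])
  have a4 := hQ.map_smul [] [] ((2⁻¹ : ℝ) * (1 + s + u - s * u)) (f * P [g])
  simp only [List.nil_append, List.cons_append] at e1 e2 e3 e4 e5 e6 e7 e8 a1 a2 a3 a4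
  rw [hR, key (f * g), key f, key g, e3, e4, e5, e6, a1, a2, a3, a4, e1, e2, e7, e8]
  rcases hu with rfl | rfl
  · rw [one_smul] at hf
    rw [evenPart_of_even hf, oddPart_of_even hf]
    rcases hs with rfl | rfl <;> rcases ht with rfl | rfl <;> norm_num <;> noncomm_ring
  · rw [neg_one_smul] at hf
    rw [evenPart_of_odd hf, oddPart_of_odd hf]
    rcases hs with rfl | rfl <;> rcases ht with rfl | rfl <;> norm_num <;> noncomm_ring
theorem parity_halves (hσ : ∀ f, σ (σ f) = f) {P : List Ω → Ω} (hP : IsFunction σ P) :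
    ∃ P₀ P₁ : List Ω → Ω, IsFunction σ P₀ ∧ IsFunction σ P₁ ∧ P = P₀ + P₁ ∧
      parity σ P₀ = (1 : ℝ) • P₀ ∧ parity σ P₁ = (-1 : ℝ) • P₁ := by
  have h := hP.parity hσ
  refine ⟨(2⁻¹ : ℝ) • (P + parity σ P), (2⁻¹ : ℝ) • (P + (-1 : ℝ) • parity σ P),
    (hP.add h).smul _, (hP.add (h.smul _)).smul _, ?_, ?_, ?_⟩
  · module
  · rw [parity_smul, parity_add, parity_parity hσ]; module
  · rw [parity_smul, parity_add, parity_smul, parity_parity hσ]; module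

theorem rawBracket_leibniz (hσ : ∀ f, σ (σ f) = f) (l : List Ω) (f g : Ω) :
    ∀ {P Q : List Ω → Ω}, IsFunction σ P → IsFunction σ Q →
      rawBracket σ P Q (l ++ [f * g]) = rawBracket σ P Q (l ++ [f]) * g
        + evenPart σ f * rawBracket σ P Q (l ++ [g])
        + oddPart σ f * σ (rawBracket σ P Q (l ++ [σ g])) := by
  induction l with
  | nil =>
    intro P Q hP hQ
    obtain ⟨P₀, P₁, hP₀, hP₁, rfl, p₀, p₁⟩ := parity_halves hσ hP
    obtain ⟨Q₀, Q₁, hQ₀, hQ₁, rfl, q₀, q₁⟩ := parity_halves hσ hQ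
    have main : ∀ {P Q : List Ω → Ω} {s t : ℝ}, (s = 1 ∨ s = -1) → (t = 1 ∨ t = -1) →
        IsFunction σ P → IsFunction σ Q → parity σ P = s • P → parity σ Q = t • Q →
        rawBracket σ P Q [f * g] = rawBracket σ P Q [f] * g + evenPart σ f * rawBracket σ P Q [g]
          + oddPart σ f * σ (rawBracket σ P Q [σ g]) := by
      intro P Q s t hs ht hP hQ hPs hQt
      have k1 := rawBracket_leibniz_aux hσ hs ht (Or.inl rfl) hP hQ hPs hQt (evenPart σ f) g
        (by rw [apply_evenPart hσ, one_smul])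
      have k2 := rawBracket_leibniz_aux hσ hs ht (Or.inr rfl) hP hQ hPs hQt (oddPart σ f) g
        (by rw [apply_oddPart hσ, neg_one_smul])
      rw [evenPart_of_even (apply_evenPart hσ f), oddPart_of_even (apply_evenPart hσ f)] at k1
      rw [evenPart_of_odd (apply_oddPart hσ f), oddPart_of_odd (apply_oddPart hσ f)] at k2
      have a0 := rawBracket_map_add hσ [] [] (evenPart σ f * g) (oddPart σ f * g) hP hQ
      have a1 := rawBracket_map_add hσ [] [] (evenPart σ f) (oddPart σ f) hP hQ
      simp only [List.nil_append, ← add_mul, evenPart_add_oddPart] at a0 a1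
      rw [a0, a1, k1, k2]
      noncomm_ring
    have m00 := main (Or.inl rfl) (Or.inl rfl) hP₀ hQ₀ p₀ q₀
    have m01 := main (Or.inl rfl) (Or.inr rfl) hP₀ hQ₁ p₀ q₁
    have m10 := main (Or.inr rfl) (Or.inl rfl) hP₁ hQ₀ p₁ q₀
    have m11 := main (Or.inr rfl) (Or.inr rfl) hP₁ hQ₁ p₁ q₁
    simp only [List.nil_append, rawBracket_add_left hσ _ hQ, rawBracket_add_right _ hP₀,
      rawBracket_add_right _ hP₁, map_add, m00, m01, m10, m11]
    noncomm_ring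
  | cons a l ih =>
    intro P Q hP hQ
    simp only [List.cons_append, rawBracket, ih hP (hQ.contr _), ih (hP.contr _) hQ,
      ih (hP.contr _) (hQ.parity hσ), map_add]
    noncomm_ring

/-- The functions are closed under the big bracket. -/
theorem IsFunction.rawBracket (hσ : ∀ f, σ (σ f) = f) {P Q : List Ω → Ω}
    (hP : IsFunction σ P) (hQ : IsFunction σ Q) :
    IsFunction σ (SuperCotangent.rawBracket σ P Q) where
  map_add l l' f g := rawBracket_map_add hσ l l' f g hP hQ
  map_smul l l' c f := rawBracket_map_smul hσ l l' c f hP hQ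
  symm_even l l' f g hf := rawBracket_symm_even hσ l l' f g hf hP hQ
  symm_odd l l' f g hf hg := rawBracket_symm_odd hσ l l' f g hf hg hP hQ
  leibniz l f g := rawBracket_leibniz hσ l f g hP hQ
  polynomial := by
    obtain ⟨m, hm⟩ := hP.polynomial
    obtain ⟨n, hn⟩ := hQ.polynomial
    exact ⟨m + n, fun l hl => rawBracket_polynomial hσ l m n hP hQ hm hn hl⟩

end Super
section Constructors

variable {Ω : Type*} [Ring Ω] [Algebra ℝ Ω] {σ : Ω →ₐ[ℝ] Ω}

/-- A function on the base, as a function on the cotangent space. -/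
def rawForm (a : Ω) : List Ω → Ω
  | [] => a
  | _ :: _ => 0

theorem isFunction_rawForm (a : Ω) : IsFunction σ (rawForm a) where
  map_add l l' f g := by cases l <;> simp [rawForm]
  map_smul l l' c f := by cases l <;> simp [rawForm]
  symm_even l l' f g h := by cases l <;> simp [rawForm]
  symm_odd l l' f g h h' := by cases l <;> simp [rawForm]
  leibniz l f g := by cases l <;> simp [rawForm]
  polynomial := ⟨1, fun l hl => by cases l <;> simp_all [rawForm]⟩

/-- A vector field on the base, as a function of degree one in the momenta. -/
def rawDer (D : Ω →ₗ[ℝ] Ω) : List Ω → Ω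
  | [f] => D f
  | _ => 0

theorem isFunction_rawDer (D : Ω →ₗ[ℝ] Ω)
    (hD : ∀ f g, D (f * g) = D f * g + evenPart σ f * D g + oddPart σ f * σ (D (σ g))) :
    IsFunction σ (rawDer D) where
  map_add l l' f g := by
    rcases l with _ | ⟨a, l⟩ <;> rcases l' with _ | ⟨b, l'⟩ <;> simp [rawDer]
  map_smul l l' c f := by
    rcases l with _ | ⟨a, l⟩ <;> rcases l' with _ | ⟨b, l'⟩ <;> simp [rawDer]
  symm_even l l' f g h := by cases l <;> simp [rawDer]
  symm_odd l l' f g h h' := by cases l <;> simp [rawDer]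
  leibniz l f g := by cases l <;> simp [rawDer, hD]
  polynomial := ⟨2, fun l hl => by
    rcases l with _ | ⟨a, _ | ⟨b, l⟩⟩ <;> simp_all [rawDer]⟩

/-- A symmetric biderivation, as a function of degree two in the momenta. -/
def rawBider (B : Ω →ₗ[ℝ] Ω →ₗ[ℝ] Ω) : List Ω → Ω
  | [f, g] => B f g
  | _ => 0

theorem isFunction_rawBider (B : Ω →ₗ[ℝ] Ω →ₗ[ℝ] Ω)
    (h0 : ∀ f g, σ f = f → B f g = B g f)
    (h1 : ∀ f g, σ f = -f → σ g = -g → B f g = -B g f)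
    (hD : ∀ a f g, B a (f * g)
      = B a f * g + evenPart σ f * B a g + oddPart σ f * σ (B a (σ g))) :
    IsFunction σ (rawBider B) where
  map_add l l' f g := by
    rcases l with _ | ⟨a, _ | ⟨b, l⟩⟩ <;> rcases l' with _ | ⟨c, _ | ⟨d, l'⟩⟩ <;> simp [rawBider]
  map_smul l l' c f := by
    rcases l with _ | ⟨a, _ | ⟨b, l⟩⟩ <;> rcases l' with _ | ⟨c, _ | ⟨d, l'⟩⟩ <;> simp [rawBider]
  symm_even l l' f g h := by
    rcases l with _ | ⟨a, _ | ⟨b, l⟩⟩ <;> rcases l' with _ | ⟨c, l'⟩ <;> simp [rawBider]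
    exact h0 f g h
  symm_odd l l' f g h h' := by
    rcases l with _ | ⟨a, _ | ⟨b, l⟩⟩ <;> rcases l' with _ | ⟨c, l'⟩ <;> simp [rawBider]
    exact h1 f g h h'
  leibniz l f g := by
    rcases l with _ | ⟨a, _ | ⟨b, l⟩⟩ <;> simp [rawBider, hD]
  polynomial := ⟨3, fun l hl => by
    rcases l with _ | ⟨a, _ | ⟨b, _ | ⟨c, l⟩⟩⟩ <;> simp_all [rawBider]⟩

end Constructors

section Skew

variable {R : Type*} [CommRing R] {L N : Type*} [AddCommGroup L] [Module R L]
  [AddCommGroup N] [Module R N]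

/-- The linear map on `⋀² L` with `X ∧ Y ↦ b X Y - b Y X`. -/
noncomputable def skewLift (b : L →ₗ[R] L →ₗ[R] N) : ⋀[R]^2 L →ₗ[R] N :=
  exteriorPower.alternatingMapLinearEquiv
    { toFun := fun v => b (v 0) (v 1) - b (v 1) (v 0)
      map_update_add' := fun v i x y => by
        fin_cases i <;> simp [Function.update] <;> abel
      map_update_smul' := fun v i c x => by
        fin_cases i <;> simp [Function.update, smul_sub]
      map_eq_zero_of_eq' := fun v i j h hij => by
        fin_cases i <;> fin_cases j <;> simp_all }

/-- The element `X ∧ Y` of `⋀² L`. -/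
noncomputable def wedge (X Y : L) : ⋀[R]^2 L := exteriorPower.ιMulti R 2 ![X, Y]

@[simp] theorem skewLift_wedge (b : L →ₗ[R] L →ₗ[R] N) (X Y : L) :
    skewLift b (wedge X Y) = b X Y - b Y X := by
  simp [skewLift, wedge]

theorem coe_wedge (X Y : L) :
    ((wedge X Y : ⋀[R]^2 L) : ExteriorAlgebra R L)
      = ExteriorAlgebra.ι R X * ExteriorAlgebra.ι R Y := by
  simp [wedge, ExteriorAlgebra.ιMulti_apply]

theorem wedge_induction {p : ⋀[R]^2 L → Prop} (hw : ∀ X Y, p (wedge X Y)) (h0 : p 0)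
    (ha : ∀ x y, p x → p y → p (x + y)) (hs : ∀ (c : R) x, p x → p (c • x)) (x : ⋀[R]^2 L) :
    p x := by
  have hx : x ∈ Submodule.span R (Set.range (exteriorPower.ιMulti R 2 (M := L))) := by
    rw [exteriorPower.ιMulti_span]; trivial
  induction hx using Submodule.span_induction with
  | mem x hx =>
    obtain ⟨v, rfl⟩ := hx
    have : v = ![v 0, v 1] := by ext i; fin_cases i <;> rfl
    rw [this]; exact hw _ _
  | zero => exact h0
  | add x y _ _ hx hy => exact ha x y hx hy
  | smul c x _ hx => exact hs c x hx

end Skew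

section Forms

variable (R : Type*) [CommRing R] (L : Type*) [AddCommGroup L] [Module R L]

/-- `Ω(A) = Γ(⋀ A^*)`, as the exterior algebra of `Γ(A^*) = Hom_R(Γ(A), R)`, `R` being the ring of
smooth functions and `L = Γ(A)`. These are the functions on the supermanifold `ΠA`. -/
abbrev Forms : Type _ := ExteriorAlgebra R (Module.Dual R L)

variable {R L}

/-- A section of `A^*` as a form. -/
noncomputable abbrev cov (α : Module.Dual R L) : Forms R L := ExteriorAlgebra.ι R α

/-- A smooth function as a form of degree zero. -/
noncomputable abbrev fn (f : R) : Forms R L := algebraMap R (Forms R L) f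

/-- The interior product `i_X a = a(X, ·, …)`. -/
noncomputable def interior : L →ₗ[R] Forms R L →ₗ[R] Forms R L :=
  CliffordAlgebra.contractLeft (Q := (0 : QuadraticForm R (Module.Dual R L))) ∘ₗ
    Module.Dual.eval R L

@[simp] theorem interior_fn (X : L) (f : R) : interior X (fn f : Forms R L) = 0 :=
  CliffordAlgebra.contractLeft_algebraMap _ _ _

@[simp] theorem interior_cov (X : L) (α : Module.Dual R L) :
    interior X (cov α) = fn (α X) :=
  CliffordAlgebra.contractLeft_ι _ _ _

theorem interior_cov_mul (X : L) (α : Module.Dual R L) (b : Forms R L) :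
    interior X (cov α * b) = α X • b - cov α * interior X b :=
  CliffordAlgebra.contractLeft_ι_mul _ _ _

theorem forms_induction {p : Forms R L → Prop} (hf : ∀ f, p (fn f)) (hc : ∀ α, p (cov α))
    (hm : ∀ a b, p a → p b → p (a * b)) (ha : ∀ a b, p a → p b → p (a + b)) (a : Forms R L) :
    p a :=
  ExteriorAlgebra.induction hf hc hm ha a

variable [Algebra ℝ R] [Module ℝ L] [IsScalarTower ℝ R L]

variable (R L) in
/-- The parity involution `a ↦ (-1)^|a| a` of `Ω(A)`. -/
noncomputable def involution : Forms R L →ₐ[ℝ] Forms R L :=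
  (CliffordAlgebra.involute (Q := (0 : QuadraticForm R (Module.Dual R L)))).restrictScalars ℝ

theorem involution_involution (a : Forms R L) : involution R L (involution R L a) = a :=
  CliffordAlgebra.involute_involute a

@[simp] theorem involution_cov (α : Module.Dual R L) : involution R L (cov α) = -cov α :=
  CliffordAlgebra.involute_ι α

@[simp] theorem involution_fn (f : R) : involution R L (fn f) = fn f :=
  AlgHom.commutes (CliffordAlgebra.involute (Q := (0 : QuadraticForm R (Module.Dual R L)))) f

theorem involution_smul (f : R) (a : Forms R L) :
    involution R L (f • a) = f • involution R L a :=
  map_smul (CliffordAlgebra.involute (Q := (0 : QuadraticForm R (Module.Dual R L)))) f a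

theorem interior_mul (X : L) (a b : Forms R L) :
    interior X (a * b) = interior X a * b + involution R L a * interior X b := by
  induction a using forms_induction generalizing b with
  | hf f => simp [← Algebra.smul_def]
  | hc α => rw [interior_cov_mul, involution_cov, interior_cov, fn, ← Algebra.smul_def]; noncomm_ring
  | hm a c ha hc => rw [mul_assoc, ha, hc, ha, map_mul]; noncomm_ring
  | ha a c ha hc => rw [add_mul, map_add, ha, hc, map_add, map_add]; noncomm_ring

theorem involution_interior (X : L) (a : Forms R L) :
    involution R L (interior X a) = -interior X (involution R L a) := by
  induction a using forms_induction with
  | hf f => simp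
  | hc α => simp
  | hm a c ha hc =>
    rw [interior_mul, map_add, map_mul, map_mul, map_mul, interior_mul, ha, hc]; noncomm_ring
  | ha a c ha hc => rw [map_add, map_add, ha, hc, map_add, map_add]; abel

/-- Graded commutativity. -/
theorem graded_comm (a b : Forms R L) :
    a * b = evenPart (involution R L) b * a + oddPart (involution R L) b * involution R L a := by
  induction a using forms_induction generalizing b with
  | hf f =>
    rw [involution_fn, ← add_mul, evenPart_add_oddPart]
    exact Algebra.commutes f b
  | hc α =>
    have key : ∀ b : Forms R L, cov α * b = involution R L b * cov α := by
      intro b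
      induction b using forms_induction with
      | hf f => rw [involution_fn]; exact (Algebra.commutes f (cov α)).symm
      | hc β =>
        rw [involution_cov, eq_comm, neg_mul, neg_eq_iff_add_eq_zero]
        exact ExteriorAlgebra.ι_add_mul_swap β α
      | hm a c ha hc => rw [← mul_assoc, ha, mul_assoc, hc, ← mul_assoc, map_mul]
      | ha a c ha hc => rw [mul_add, ha, hc, map_add, add_mul]
    rw [key, involution_cov, mul_neg, ← sub_eq_add_neg, ← sub_mul]
    congr 1
    simp only [evenPart, oddPart]; module
  | hm a c ha hc =>
    have h0 := ha (evenPart (involution R L) b)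
    have h1 := ha (oddPart (involution R L) b)
    rw [evenPart_of_even (apply_evenPart involution_involution b),
      oddPart_of_even (apply_evenPart involution_involution b), zero_mul, add_zero] at h0
    rw [evenPart_of_odd (apply_oddPart involution_involution b),
      oddPart_of_odd (apply_oddPart involution_involution b), zero_mul, zero_add] at h1
    rw [mul_assoc, hc, mul_add, ← mul_assoc, ← mul_assoc, h0, h1, map_mul]
    noncomm_ring
  | ha a c ha hc => rw [add_mul, ha, hc, map_add]; noncomm_ring

end Forms

section Tensors

variable {R : Type*} [CommRing R] {L : Type*} [AddCommGroup L] [Module R L]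

/-- `π♯(α) = π(α, ·)`, where `(X ∧ Y)(α, β) = α(X) β(Y) - α(Y) β(X)`. -/
noncomputable def sharp : ⋀[R]^2 L →ₗ[R] Module.Dual R L →ₗ[R] L :=
  skewLift (N := Module.Dual R L →ₗ[R] L) (LinearMap.mk₂ R (fun X Y => (Module.Dual.eval R L X).smulRight Y)
    (fun X X' Y => by ext; simp [add_smul]) (fun c X Y => by ext; simp [mul_smul])
    (fun X Y Y' => by ext; simp) (fun c X Y => LinearMap.ext fun α => smul_comm (α X) c Y))

theorem sharp_wedge (X Y : L) (α : Module.Dual R L) :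
    sharp (wedge X Y) α = α X • Y - α Y • X := by
  simp [sharp]

/-- `ω♭(X) = ω(X, ·)`, where `(α ∧ β)(X, Y) = α(X) β(Y) - α(Y) β(X)`. -/
noncomputable def flat : ⋀[R]^2 (Module.Dual R L) →ₗ[R] L →ₗ[R] Module.Dual R L :=
  skewLift (L := Module.Dual R L) (N := L →ₗ[R] Module.Dual R L)
    (LinearMap.mk₂ R (fun α β => LinearMap.smulRight α β)
    (fun α α' β => by ext; simp [add_mul]) (fun c α β => by ext; simp [mul_assoc])
    (fun α β β' => by ext; simp [mul_add]) (fun c α β => by ext; simp [mul_left_comm]))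

theorem flat_wedge (α β : Module.Dual R L) (X : L) :
    flat (wedge α β) X = α X • β - β X • α := by
  simp [flat]

theorem interior_coe (ω : ⋀[R]^2 (Module.Dual R L)) (X : L) :
    interior X (ω : Forms R L) = cov (flat ω X) := by
  induction ω using wedge_induction with
  | hw α β =>
    rw [coe_wedge, flat_wedge, cov, map_sub, map_smul, map_smul]
    rw [show ExteriorAlgebra.ι R α * ExteriorAlgebra.ι R β = cov α * cov β from rfl,
      interior_cov_mul, interior_cov, fn, ← Algebra.commutes, ← Algebra.smul_def]
  | h0 => simp
  | ha x y hx hy => simp [hx, hy]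
  | hs c x hx => simp [hx]

/-- The algebra map `a ↦ a + ε i_N a` into dual numbers, used to construct `i_N`. -/
noncomputable def endLift (N : L →ₗ[R] L) : Forms R L →ₐ[R] TrivSqZeroExt (Forms R L) (Forms R L) :=
  ExteriorAlgebra.lift R
    ⟨(TrivSqZeroExt.inlAlgHom R (Forms R L) (Forms R L)).toLinearMap ∘ₗ ExteriorAlgebra.ι R
      + (TrivSqZeroExt.inrHom (Forms R L) (Forms R L)).restrictScalars R ∘ₗ
        ExteriorAlgebra.ι R ∘ₗ N.dualMap, fun α => by
      ext
      · simp
      · simp [ExteriorAlgebra.ι_add_mul_swap]⟩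

/-- `i_N`: the derivation of `Ω(A)` of degree zero which vanishes on functions and sends a one-form
`α` to `ᵗN α = α ∘ N`. -/
noncomputable def endDer (N : L →ₗ[R] L) : Forms R L →ₗ[R] Forms R L :=
  (TrivSqZeroExt.sndHom (Forms R L) (Forms R L)).restrictScalars R ∘ₗ (endLift N).toLinearMap

theorem fst_endLift (N : L →ₗ[R] L) (a : Forms R L) : (endLift N a).fst = a := by
  have : (TrivSqZeroExt.fstHom R (Forms R L) (Forms R L)).comp (endLift N) = AlgHom.id R _ := by
    ext α; simp [endLift]
  exact DFunLike.congr_fun this a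

theorem endDer_cov (N : L →ₗ[R] L) (α : Module.Dual R L) :
    endDer N (cov α) = cov (α ∘ₗ N) := by
  simp [endDer, endLift, LinearMap.dualMap_apply']

theorem endDer_fn (N : L →ₗ[R] L) (f : R) : endDer N (fn f : Forms R L) = 0 := by
  simp [endDer, TrivSqZeroExt.algebraMap_eq_inl']

theorem endDer_mul (N : L →ₗ[R] L) (a b : Forms R L) :
    endDer N (a * b) = endDer N a * b + a * endDer N b := by
  simp [endDer, fst_endLift, add_comm]

end Tensors


section Functions

variable (R : Type*) [CommRing R] [Algebra ℝ R] (L : Type*) [AddCommGroup L] [Module R L]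
  [Module ℝ L] [IsScalarTower ℝ R L]

/-- `C^∞(T^*ΠA)`: the functions on the cotangent space of the supermanifold `ΠA`. -/
def CotangentFunctions : Submodule ℝ (List (Forms R L) → Forms R L) where
  carrier := {P | IsFunction (involution R L) P}
  add_mem' hP hQ := hP.add hQ
  zero_mem' := IsFunction.zero
  smul_mem' c _ hP := hP.smul c

variable {R L}

noncomputable instance : CoeFun (CotangentFunctions R L) fun _ => List (Forms R L) → Forms R L :=
  ⟨Subtype.val⟩

/-- The big bracket: the canonical Poisson bracket on `C^∞(T^*ΠA)`. -/
noncomputable instance : Bracket (CotangentFunctions R L) (CotangentFunctions R L) :=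
  ⟨fun P Q => ⟨rawBracket (involution R L) P Q,
    IsFunction.rawBracket involution_involution P.2 Q.2⟩⟩

/-- A form as an element of `C^∞(T^*ΠA)`. -/
noncomputable def ofForm (a : Forms R L) : CotangentFunctions R L :=
  ⟨rawForm a, isFunction_rawForm a⟩

theorem involution_endDer (N : L →ₗ[R] L) (a : Forms R L) :
    involution R L (endDer N a) = endDer N (involution R L a) := by
  induction a using forms_induction with
  | hf f => rw [involution_fn, endDer_fn, map_zero]
  | hc α => rw [involution_cov, map_neg, endDer_cov, involution_cov]
  | hm a b ha hb => rw [endDer_mul, map_add, map_mul, map_mul, map_mul, endDer_mul, ha, hb]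
  | ha a b ha hb => rw [map_add, map_add, map_add, map_add, ha, hb]

/-- A `(1,1)`-tensor `N` as an element of `C^∞(T^*ΠA)` (of bidegree `(1,1)`): it acts as `i_N`, so that
`{X, N} = N X` for sections `X` of `A` and `{α, N} = -ᵗN α` for sections `α` of `A^*`. -/
noncomputable def ofEnd (N : L →ₗ[R] L) : CotangentFunctions R L :=
  ⟨rawDer ((endDer N).restrictScalars ℝ), isFunction_rawDer _ fun f g => by
    have h := evenPart_add_oddPart (σ := involution R L) f
    simp only [LinearMap.coe_restrictScalars, endDer_mul, involution_endDer,
      involution_involution]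
    rw [add_assoc, ← add_mul, h]⟩

/-- `(X ∧ Y, a, b) ↦ (-1)^|a| (i_X a · i_Y b - i_Y a · i_X b)`, which is `{{X Y, a}, b}`. -/
noncomputable def bivectorPairing :
    ⋀[R]^2 L →ₗ[R] Forms R L →ₗ[R] Forms R L →ₗ[R] Forms R L :=
  skewLift (N := Forms R L →ₗ[R] Forms R L →ₗ[R] Forms R L)
    (LinearMap.mk₂ R (fun X Y => (LinearMap.mul R (Forms R L)).compl₁₂
        (interior X ∘ₗ (CliffordAlgebra.involute
          (Q := (0 : QuadraticForm R (Module.Dual R L)))).toLinearMap) (interior Y))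
      (fun X X' Y => by ext; simp [add_mul]) (fun c X Y => by ext; simp)
      (fun X Y Y' => by ext; simp [mul_add]) (fun c X Y => by ext; simp))

theorem bivectorPairing_wedge (X Y : L) (a b : Forms R L) :
    bivectorPairing (wedge X Y) a b = interior X (involution R L a) * interior Y b
      - interior Y (involution R L a) * interior X b := by
  simp [bivectorPairing]; rfl

theorem bivectorPairing_symm_even (π : ⋀[R]^2 L) (f g : Forms R L) (hf : involution R L f = f) :
    bivectorPairing π f g = bivectorPairing π g f := by
  induction π using wedge_induction with
  | hw X Y =>
    have h : ∀ (X : L) (b : Forms R L), interior X f * b = involution R L b * interior X f := by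
      intro X b
      have := graded_comm (interior X f) b
      rw [involution_interior, hf, mul_neg, ← sub_eq_add_neg, ← sub_mul] at this
      rw [this]; congr 1
      simp only [evenPart, oddPart]; module
    rw [bivectorPairing_wedge, bivectorPairing_wedge, hf, h, h, involution_interior,
      involution_interior]
    noncomm_ring
  | h0 => simp
  | ha x y hx hy => simp [hx, hy]
  | hs c x hx => simp [hx]

theorem bivectorPairing_symm_odd (π : ⋀[R]^2 L) (f g : Forms R L) (hf : involution R L f = -f)
    (hg : involution R L g = -g) :
    bivectorPairing π f g = -bivectorPairing π g f := by
  induction π using wedge_induction with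
  | hw X Y =>
    have h : ∀ (X : L) (b : Forms R L), interior X f * b = b * interior X f := by
      intro X b
      have := graded_comm (interior X f) b
      rw [involution_interior, hf, map_neg, neg_neg, ← add_mul, evenPart_add_oddPart] at this
      exact this
    rw [bivectorPairing_wedge, bivectorPairing_wedge, hf, hg, map_neg, map_neg, map_neg, map_neg,
      neg_mul, neg_mul, h, h]
    noncomm_ring
  | h0 => simp
  | ha x y hx hy => simp [hx, hy]; abel
  | hs c x hx => simp [hx]

theorem bivectorPairing_leibniz (π : ⋀[R]^2 L) (a f g : Forms R L) :
    bivectorPairing π a (f * g) = bivectorPairing π a f * g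
      + evenPart (involution R L) f * bivectorPairing π a g
      + oddPart (involution R L) f
        * involution R L (bivectorPairing π a (involution R L g)) := by
  induction π using wedge_induction with
  | hw X Y =>
    have h : ∀ X Y : L, interior X (involution R L a) * interior Y (f * g)
        = interior X (involution R L a) * interior Y f * g
          + evenPart (involution R L) f * (interior X (involution R L a) * interior Y g)
          + oddPart (involution R L) f * involution R L
            (interior X (involution R L a) * interior Y (involution R L g)) := by
      intro X Y
      have e : involution R L f = evenPart (involution R L) f - oddPart (involution R L) f := by
        simp only [evenPart, oddPart]; module
      have k := graded_comm (interior X (involution R L a)) (involution R L f)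
      have k1 : evenPart (involution R L) (involution R L f) = evenPart (involution R L) f := by
        simp only [evenPart, involution_involution, add_comm]
      have k2 : oddPart (involution R L) (involution R L f) = -oddPart (involution R L) f := by
        simp only [oddPart, involution_involution]; module
      rw [k1, k2] at k
      rw [interior_mul, mul_add, ← mul_assoc, ← mul_assoc _ (involution R L f), k, map_mul,
        involution_interior Y, involution_involution]
      noncomm_ring
    rw [bivectorPairing_wedge, bivectorPairing_wedge, bivectorPairing_wedge,
      bivectorPairing_wedge, h, h, map_sub]
    noncomm_ring
  | h0 => simp
  | ha x y hx hy => simp only [map_add, LinearMap.add_apply, hx, hy]; noncomm_ring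
  | hs c x hx =>
    simp only [map_smul, LinearMap.smul_apply, hx, involution_smul, smul_add, smul_mul_assoc,
      mul_smul_comm]

/-- A bivector as an element of `C^∞(T^*ΠA)` (of bidegree `(2,0)`): `X ∧ Y` is the product of the
fibre-linear functions `X` and `Y`, so that `{α, π} = π♯ α` for sections `α` of `A^*`. -/
noncomputable def ofBivector (π : ⋀[R]^2 L) : CotangentFunctions R L :=
  ⟨rawBider (LinearMap.mk₂ ℝ (fun f g => bivectorPairing π f g)
      (fun f f' g => by simp) (fun c f g => by rw [LinearMap.map_smul_of_tower]; rfl)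
      (fun f g g' => by simp) (fun c f g => by rw [LinearMap.map_smul_of_tower])),
    isFunction_rawBider _ (bivectorPairing_symm_even π) (bivectorPairing_symm_odd π)
      (bivectorPairing_leibniz π)⟩

theorem dual_sharp (π : ⋀[R]^2 L) (α β : Module.Dual R L) : β (sharp π α) = -α (sharp π β) := by
  induction π using wedge_induction with
  | hw X Y => simp [sharp_wedge]; ring
  | h0 => simp
  | ha x y hx hy => simp [hx, hy]; ring
  | hs c x hx => simp [hx]

theorem flat_skew (ω : ⋀[R]^2 (Module.Dual R L)) (X Y : L) : flat ω X Y = -flat ω Y X := by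
  induction ω using wedge_induction with
  | hw α β => simp [flat_wedge]; ring
  | h0 => simp
  | ha x y hx hy => simp [hx, hy]; ring
  | hs c x hx => simp [hx]

theorem interior_endDer (N : L →ₗ[R] L) (X : L) (a : Forms R L) :
    interior X (endDer N a) = endDer N (interior X a) + interior (N X) a := by
  induction a using forms_induction with
  | hf f => simp only [endDer_fn, interior_fn, map_zero, add_zero]
  | hc α => simp only [endDer_cov, interior_cov, endDer_fn, zero_add, LinearMap.comp_apply]
  | hm a b ha hb =>
    rw [endDer_mul, map_add, interior_mul, interior_mul, interior_mul, interior_mul, map_add,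
      endDer_mul, endDer_mul, ha, hb, involution_endDer]
    noncomm_ring
  | ha a b ha hb => simp only [map_add, ha, hb]; abel

/-- `ω_N = ½ i_N ω`, that is, the form `½ (ω(N·, ·) + ω(·, N·))`. For `N = π♯ ∘ ω♭` this is
`ω(N·, ·)`, see `interior_omegaN`. -/
noncomputable def omegaN (ω : ⋀[R]^2 (Module.Dual R L)) (N : L →ₗ[R] L) : Forms R L :=
  (2⁻¹ : ℝ) • endDer N (ω : Forms R L)

/-- `ω_N(X, ·) = ω(N X, ·)` for `N = π♯ ∘ ω♭`. -/
theorem interior_omegaN (π : ⋀[R]^2 L) (ω : ⋀[R]^2 (Module.Dual R L)) (X : L) :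
    interior X (omegaN ω (sharp π ∘ₗ flat ω)) = cov (flat ω ((sharp π ∘ₗ flat ω) X)) := by
  have h : flat ω X ∘ₗ (sharp π ∘ₗ flat ω) = flat ω ((sharp π ∘ₗ flat ω) X) := by
    ext Y
    simp only [LinearMap.comp_apply]
    rw [dual_sharp, flat_skew, neg_neg]
  rw [omegaN, LinearMap.map_smul_of_tower, interior_endDer, interior_coe, interior_coe, endDer_cov,
    h]
  module

end Functions


section Structures

variable {R : Type*} [CommRing R] [Algebra ℝ R] {L : Type*} [AddCommGroup L] [Module R L]
  [Module ℝ L] [IsScalarTower ℝ R L]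

/-- `P` has bidegree `(ε, δ)`: it is homogeneous of degree `ε` in the momenta of `T^*ΠA → ΠA`, and, as
the big bracket lowers the total degree by two, it sends forms of degrees `k₁, …, k_ε` to a form of
degree `k₁ + … + k_ε + δ - ε` (so to zero if this number is negative). -/
def HasBidegree (P : List (Forms R L) → Forms R L) (ε δ : ℕ) : Prop :=
  (∀ l, l.length ≠ ε → P l = 0) ∧
    ∀ (l : List (Forms R L)) (k : List ℕ),
      List.Forall₂ (fun f i => f ∈ ⋀[R]^i (Module.Dual R L)) l k →
        (∀ m : ℕ, m + ε = k.sum + δ → P l ∈ ⋀[R]^m (Module.Dual R L)) ∧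
          (k.sum + δ < ε → P l = 0)

/-- The twist `e^τ P = ∑ₖ (1/k!) {…{{P, τ}, τ}, …, τ}`. -/
noncomputable def twist (τ P : CotangentFunctions R L) : CotangentFunctions R L :=
  ∑ᶠ k : ℕ, ((k.factorial : ℝ)⁻¹) • (fun Q : CotangentFunctions R L => ⁅Q, τ⁆)^[k] P

/-- The series defining `e^τ P` is a finite sum. -/
def TwistTerminates (τ P : CotangentFunctions R L) : Prop :=
  ∃ n : ℕ, ∀ k ≥ n, (fun Q : CotangentFunctions R L => ⁅Q, τ⁆)^[k] P = 0

variable (R L) in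
/-- A Lie algebroid structure on `A`, with `L = Γ(A)`: a Lie bracket on the sections and an anchor,
given on sections as a function-linear map to vector fields (derivations of the ring of functions),
subject to the Leibniz rule. -/
structure LieAlgebroid where
  bracket : L →ₗ[ℝ] L →ₗ[ℝ] L
  anchor : L →ₗ[R] Derivation ℝ R R
  bracket_self : ∀ X, bracket X X = 0
  jacobi : ∀ X Y Z,
    bracket X (bracket Y Z) + bracket Y (bracket Z X) + bracket Z (bracket X Y) = 0
  leibniz : ∀ (X Y : L) (f : R), bracket X (f • Y) = f • bracket X Y + anchor X f • Y

namespace LieAlgebroid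

variable (𝓐 : LieAlgebroid R L)

/-- `μ` is the function on `T^*ΠA` that corresponds to the Lie algebroid structure: it has bidegree
`(1, 2)` (shifted bidegree `(0, 1)`), `{μ, ·}` is the differential `d` of the algebroid,
`d f (X) = ρ(X) f` and `dα(X, Y) = ρ(X) α(Y) - ρ(Y) α(X) - α([X, Y])`, and `{μ, μ} = 0`.
Elements of bidegree `(1, 2)` are the derivations of degree one of `Ω(A)`, with `d a = μ [a]`. -/
structure IsHamiltonian (μ : CotangentFunctions R L) : Prop where
  bidegree : HasBidegree μ 1 2
  apply_fn : ∀ (f : R) (X : L), interior X (μ [fn f]) = fn (𝓐.anchor X f)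
  apply_cov : ∀ (α : Module.Dual R L) (X Y : L),
    interior Y (interior X (μ [cov α]))
      = fn (𝓐.anchor X (α Y) - 𝓐.anchor Y (α X) - α (𝓐.bracket X Y))
  bracket_self_eq_zero : ⁅μ, μ⁆ = 0

/-- The Schouten-Nijenhuis bracket `[X₁ ∧ X₂, Y₁ ∧ Y₂]`, equal to
`∑ (-1)^(i+j) [X_i, Y_j] ∧ X_{3-i} ∧ Y_{3-j}`. -/
noncomputable def schoutenWedge (X₁ X₂ Y₁ Y₂ : L) : ExteriorAlgebra R L :=
  let e := ExteriorAlgebra.ι R (M := L)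
  e (𝓐.bracket X₁ Y₁) * e X₂ * e Y₂ - e (𝓐.bracket X₁ Y₂) * e X₂ * e Y₁
    - e (𝓐.bracket X₂ Y₁) * e X₁ * e Y₂ + e (𝓐.bracket X₂ Y₂) * e X₁ * e Y₁

/-- `[π, π]_SN = 0`: write `π` as a finite sum of wedges and expand biadditively (the outcome does not
depend on how `π` is written). -/
def IsPoisson (π : ⋀[R]^2 L) : Prop :=
  ∃ (k : ℕ) (X Y : Fin k → L), π = ∑ i, wedge (X i) (Y i) ∧
    ∑ i, ∑ j, 𝓐.schoutenWedge (X i) (Y i) (X j) (Y j) = 0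

end LieAlgebroid

/-- The Lie derivative `i_X d + d i_X`, with `d = {μ, ·}`. -/
noncomputable def lieDerivative (μ : CotangentFunctions R L) (X : L) (a : Forms R L) : Forms R L :=
  interior X (μ [a]) + μ [interior X a]

/-- `[α, β]_π = L_{π♯α} β - L_{π♯β} α - d(π(α, β))`. -/
noncomputable def koszulBracket (μ : CotangentFunctions R L) (π : ⋀[R]^2 L)
    (α β : Module.Dual R L) : Forms R L :=
  lieDerivative μ (sharp π α) (cov β) - lieDerivative μ (sharp π β) (cov α)
    - μ [fn (β (sharp π α))]

/-- `P` is the function on `T^*ΠA` of bidegree `(2, 1)` that corresponds to the bracket `[·,·]_π` and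
the anchor `ρ ∘ π♯` on `A^*`: `{{P, α}, β} = [α, β]_π` and `{{P, α}, f} = ρ(π♯ α) f`. -/
structure IsKoszulHamiltonian (𝓐 : LieAlgebroid R L) (μ : CotangentFunctions R L)
    (π : ⋀[R]^2 L) (P : CotangentFunctions R L) : Prop where
  bidegree : HasBidegree P 2 1
  apply_cov_cov : ∀ α β : Module.Dual R L, P [cov α, cov β] = koszulBracket μ π α β
  apply_cov_fn : ∀ (α : Module.Dual R L) (f : R),
    P [cov α, fn f] = fn (𝓐.anchor (sharp π α) f)

/-- `d_N = {{N, μ}, ·} = i_N d - d i_N`. -/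
noncomputable def deformedDifferential (μ : CotangentFunctions R L) (N : L →ₗ[R] L)
    (a : Forms R L) : Forms R L :=
  endDer N (μ [a]) - μ [endDer N a]

/-- `P` is the function on `T^*ΠA` of bidegree `(1, 2)`, i.e. the derivation of degree one of
`Ω(A) = Γ(⋀ A^*)`, given by `f ↦ d_N f` on functions and `α ↦ d_N α + i_{π♯α} H` on sections of
`A^*`. -/
structure IsBackgroundDerivation (μ : CotangentFunctions R L) (π : ⋀[R]^2 L) (N : L →ₗ[R] L)
    (H : Forms R L) (P : CotangentFunctions R L) : Prop where
  bidegree : HasBidegree P 1 2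
  apply_fn : ∀ f : R, P [fn f] = deformedDifferential μ N (fn f)
  apply_cov : ∀ α : Module.Dual R L,
    P [cov α] = deformedDifferential μ N (cov α) + interior (sharp π α) H

/-- The function `{π + N, μ + H} + ψ` on `T^*ΠA`: the Lie quasi-bialgebroid structure on `(A^*, A)`
induced by `(π, N, ψ, H)`. -/
noncomputable def inducedStructure (μ : CotangentFunctions R L) (π : ⋀[R]^2 L) (N : L →ₗ[R] L)
    (ψ H : Forms R L) : CotangentFunctions R L :=
  ⁅ofBivector π + ofEnd N, μ + ofForm H⁆ + ofForm ψ

end Structures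

section Manifold
open scoped Manifold ContDiff Bundle

variable {n : ℕ} {M : Type*} [TopologicalSpace M] [ChartedSpace (EuclideanSpace ℝ (Fin n)) M]
  {F : Type*} [NormedAddCommGroup F] [NormedSpace ℝ F] {A : M → Type*}
  [TopologicalSpace (Bundle.TotalSpace F A)] [∀ x, TopologicalSpace (A x)] [FiberBundle F A]
  [∀ x, AddCommGroup (A x)] [∀ x, Module ℝ (A x)] [VectorBundle ℝ F A]

/-- Sections of a smooth vector bundle form a module over the smooth functions. -/
noncomputable instance sectionModule :
    Module C^∞⟮𝓡 n, M; ℝ⟯ Cₛ^∞⟮𝓡 n; F, A⟯ where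
  smul f s := ⟨fun x => f x • s x, f.contMDiff.smul_section s.contMDiff⟩
  one_smul s := by ext x; exact one_smul ℝ (s x)
  mul_smul f g s := by ext x; exact mul_smul (f x) (g x) (s x)
  smul_zero f := by ext x; exact smul_zero (f x)
  smul_add f s t := by ext x; exact smul_add (f x) (s x) (t x)
  add_smul f g s := by ext x; exact add_smul (f x) (g x) (s x)
  zero_smul s := by ext x; exact zero_smul ℝ (s x)

instance sectionIsScalarTower :
    IsScalarTower ℝ C^∞⟮𝓡 n, M; ℝ⟯ Cₛ^∞⟮𝓡 n; F, A⟯ where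
  smul_assoc c f s := by ext x; exact smul_assoc c (f x) (s x)

end Manifold

end SuperCotangent

open SuperCotangent
open scoped Manifold ContDiff

/-! Write K = {π, μ}. Since {N, H} = i_N H, bilinearity gives S = K + δ + φ with δ = {N, μ} + {π, H}
and φ = ψ + i_N H; the three terms have degree 2, 1, 0 in the momenta. By the Jacobi identity,
bracketing with an even function is a derivation of the big bracket (`bracket_bracket_even`), so
both twists reduce to a few brackets.

For -π: {μ, -π} = K by antisymmetry, and {K, π} = 0, because on three one-forms {{π, μ}, π} is minus
the Schouten bracket [π, π] (`IsHamiltonian.triple_eq`). Hence e^{-π}μ = μ + K. For -ω: from {μ, ω}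
= dω = -H and {π, ω} = -N follows {K, ω} = -δ. The same rule gives {δ, ω} = -2 i_N H - d i_N ω =
-2φ, because ω_N = ½ i_N ω, and {φ, ω} = 0. The factor 2 cancels 1/2!, so e^{-ω}K = K + δ + φ = S.

Bracketing {μ, μ} = 0 twice with π gives {K, K} = 0. Twisting by ω carries this over to {S, S} = 0;
`bracket_self_eq_zero_of_twist` extracts it from the derivation rule alone.

The foundation has two parts. The big bracket is a recursion on lists of arguments in which
contraction with a form acts as a graded derivation (`contr_rawBracket_of_homogeneous`); graded
antisymmetry and Jacobi follow by induction on the list. And a function on T^*ΠA is determined by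
its values on functions and one-forms (`CotangentFunctions.ext_generators`). Counting degrees leaves
few such values, which identify K with μ_π, δ with d_N^H and {π, ω} with -N. -/

namespace SuperCotangent

/-! ### Graded antisymmetry and Jacobi identity of the big bracket. -/

section Jacobi

variable {Ω : Type*} [Ring Ω] [Algebra ℝ Ω] {σ : Ω →ₐ[ℝ] Ω}

/-- The sign `(-1)^(|a| |b|)` in terms of `s = (-1)^|a|` and `t = (-1)^|b|`. -/
noncomputable def koszulSign (s t : ℝ) : ℝ := 2⁻¹ * (1 + s + t - s * t)

theorem koszulSign_one_left (t : ℝ) : koszulSign 1 t = 1 := by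
  simp only [koszulSign]; ring

theorem koszulSign_one_right (s : ℝ) : koszulSign s 1 = 1 := by
  simp only [koszulSign]; ring

theorem koszulSign_neg_one_neg_one : koszulSign (-1) (-1) = -1 := by
  norm_num [koszulSign]

theorem sign_mul {a b : ℝ} (ha : a = 1 ∨ a = -1) (hb : b = 1 ∨ b = -1) :
    a * b = 1 ∨ a * b = -1 := by
  rcases ha with rfl | rfl <;> rcases hb with rfl | rfl <;> simp

/-- Merges the two symmetry axioms into one sign rule; for an odd and an even entry, in this order,
the even axiom is read backwards. -/
theorem IsFunction.apply_pair_swap {P : List Ω → Ω} (hP : IsFunction σ P) {s t : ℝ}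
    (hs : s = 1 ∨ s = -1) (ht : t = 1 ∨ t = -1) {a b : Ω} (ha : σ a = s • a) (hb : σ b = t • b)
    (l : List Ω) : P (a :: b :: l) = koszulSign s t • P (b :: a :: l) := by
  rcases hs with rfl | rfl
  · rw [koszulSign_one_left, one_smul]
    exact hP.symm_even [] l a b (by simpa using ha)
  · rcases ht with rfl | rfl
    · rw [koszulSign_one_right, one_smul]
      exact (hP.symm_even [] l b a (by simpa using hb)).symm
    · rw [koszulSign_neg_one_neg_one, neg_one_smul]
      exact hP.symm_odd [] l a b (by simpa using ha) (by simpa using hb)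

/-- For homogeneous P and Q, one of the even and odd parts of `P []` vanishes, and the split in the
definition of `rawBracket` collapses to a single Koszul sign. -/
theorem rawBracket_nil_of_homogeneous {P Q : List Ω → Ω} {s t : ℝ} (hs : s = 1 ∨ s = -1)
    (ht : t = 1 ∨ t = -1) (hQ : IsFunction σ Q) (hPs : parity σ P = s • P)
    (hQt : parity σ Q = t • Q) :
    rawBracket σ P Q [] = P [Q []] - koszulSign s t • Q [P []] := by
  have hc : σ (P []) = s • P [] := congrFun hPs []
  rw [rawBracket, koszulSign_aux hs ht hQ hQt [] hc, koszulSign]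

/-- The recursive clause of `rawBracket` for homogeneous entries. It drives every induction on
lists: the list loses its head, while P or Q is replaced by its contraction, which is again a
homogeneous function. -/
theorem contr_rawBracket_of_homogeneous (hσ : ∀ f, σ (σ f) = f) {P Q : List Ω → Ω} {t u : ℝ}
    (ht : t = 1 ∨ t = -1) (hu : u = 1 ∨ u = -1) (hP : IsFunction σ P) (hQ : IsFunction σ Q)
    (hQt : parity σ Q = t • Q) {f : Ω} (hf : σ f = u • f) :
    contr (rawBracket σ P Q) f
      = rawBracket σ P (contr Q f) + koszulSign u t • rawBracket σ (contr P f) Q := by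
  funext l
  simp only [contr, Pi.add_apply, Pi.smul_apply]
  rw [rawBracket]
  rcases hu with rfl | rfl
  · rw [one_smul] at hf
    rw [evenPart_of_even hf, oddPart_of_even hf, hP.contr_zero,
      rawBracket_zero_left hσ (hQ.parity hσ), koszulSign_one_left, one_smul, add_zero]
  · rw [neg_one_smul] at hf
    rw [evenPart_of_odd hf, oddPart_of_odd hf, hP.contr_zero, rawBracket_zero_left hσ hQ, hQt,
      rawBracket_smul_right _ _ (hP.contr f), add_zero]
    rcases ht with rfl | rfl
    · rw [koszulSign_one_right]
    · rw [koszulSign_neg_one_neg_one]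

theorem parity_rawBracket_of_homogeneous (hσ : ∀ f, σ (σ f) = f) {P Q : List Ω → Ω} {s t : ℝ}
    (hP : IsFunction σ P) (hQ : IsFunction σ Q) (hPs : parity σ P = s • P)
    (hQt : parity σ Q = t • Q) :
    parity σ (rawBracket σ P Q) = (s * t) • rawBracket σ P Q := by
  funext l
  have h3 : IsFunction σ (t • Q) := hQt ▸ hQ.parity hσ
  rw [parity_rawBracket hσ l hP hQ, hPs, hQt, rawBracket_smul_left hσ s _ h3,
    rawBracket_smul_right t _ hP, smul_smul]
  rfl

/-- By additivity the head of a list may be taken homogeneous; this reduces each inductive step to a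
finite check of signs. -/
theorem eq_of_contr_homogeneous (hσ : ∀ f, σ (σ f) = f) {P Q : List Ω → Ω}
    (hP : IsFunction σ P) (hQ : IsFunction σ Q) (l : List Ω)
    (h : ∀ (u : ℝ) (f : Ω), (u = 1 ∨ u = -1) → σ f = u • f → contr P f l = contr Q f l) (f : Ω) :
    P (f :: l) = Q (f :: l) := by
  have h0 := h 1 (evenPart σ f) (Or.inl rfl) (by rw [apply_evenPart hσ, one_smul])
  have h1 := h (-1) (oddPart σ f) (Or.inr rfl) (by rw [apply_oddPart hσ, neg_one_smul])
  have e : ∀ {P : List Ω → Ω}, IsFunction σ P →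
      P (f :: l) = contr P (evenPart σ f) l + contr P (oddPart σ f) l := fun {P} hP => by
    have := hP.map_add [] l (evenPart σ f) (oddPart σ f)
    rwa [evenPart_add_oddPart] at this
  rw [e hP, e hQ, h0, h1]

/-- Graded antisymmetry of the big bracket. -/
theorem rawBracket_swap (hσ : ∀ f, σ (σ f) = f) (l : List Ω) :
    ∀ {P Q : List Ω → Ω} {s t : ℝ}, (s = 1 ∨ s = -1) → (t = 1 ∨ t = -1) →
      IsFunction σ P → IsFunction σ Q → parity σ P = s • P → parity σ Q = t • Q →
      rawBracket σ P Q l = -(koszulSign s t • rawBracket σ Q P l) := by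
  induction l with
  | nil =>
    intro P Q s t hs ht hP hQ hPs hQt
    rw [rawBracket_nil_of_homogeneous hs ht hQ hPs hQt,
      rawBracket_nil_of_homogeneous ht hs hP hQt hPs]
    rcases hs with rfl | rfl <;> rcases ht with rfl | rfl <;>
      simp only [koszulSign_one_left, koszulSign_one_right, koszulSign_neg_one_neg_one] <;> module
  | cons f l ih =>
    intro P Q s t hs ht hP hQ hPs hQt
    have := eq_of_contr_homogeneous hσ (hP.rawBracket hσ hQ)
      ((hQ.rawBracket hσ hP).smul (-koszulSign s t)) l (fun u f hu hf => ?_) f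
    · rw [this, Pi.smul_apply, neg_smul]
    have e : contr (-koszulSign s t • rawBracket σ Q P) f
        = -koszulSign s t • contr (rawBracket σ Q P) f := rfl
    rw [e, contr_rawBracket_of_homogeneous hσ ht hu hP hQ hQt hf,
      contr_rawBracket_of_homogeneous hσ hs hu hQ hP hPs hf]
    simp only [Pi.add_apply, Pi.smul_apply]
    rw [ih hs (sign_mul ht hu) hP (hQ.contr f) hPs (parity_contr hσ hQ hQt hf),
      ih (sign_mul hs hu) ht (hP.contr f) hQ (parity_contr hσ hP hPs hf) hQt]
    rcases hs with rfl | rfl <;> rcases ht with rfl | rfl <;> rcases hu with rfl | rfl <;>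
      simp only [koszulSign_one_left, koszulSign_one_right, koszulSign_neg_one_neg_one, mul_one,
        mul_neg, neg_neg] <;> module

theorem rawBracket_singleton_of_homogeneous (hσ : ∀ f, σ (σ f) = f) {P Q : List Ω → Ω}
    {s t u : ℝ} (hs : s = 1 ∨ s = -1) (ht : t = 1 ∨ t = -1) (hu : u = 1 ∨ u = -1)
    (hP : IsFunction σ P) (hQ : IsFunction σ Q) (hPs : parity σ P = s • P)
    (hQt : parity σ Q = t • Q) {f : Ω} (hf : σ f = u • f) :
    rawBracket σ P Q [f] = P [Q [f]] - koszulSign s (t * u) • Q [f, P []]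
      + koszulSign u t • (P [f, Q []] - koszulSign (s * u) t • Q [P [f]]) := by
  have := congrFun (contr_rawBracket_of_homogeneous hσ ht hu hP hQ hQt hf) []
  simp only [Pi.add_apply, Pi.smul_apply] at this
  rw [rawBracket_nil_of_homogeneous hs (sign_mul ht hu) (hQ.contr f) hPs (parity_contr hσ hQ hQt hf),
    rawBracket_nil_of_homogeneous (sign_mul hs hu) ht hQ (parity_contr hσ hP hPs hf) hQt] at this
  exact this

theorem IsFunction.apply_singleton_sub_smul {P : List Ω → Ω} (hP : IsFunction σ P) (a b : Ω)
    (c : ℝ) : P [a - c • b] = P [a] - c • P [b] := by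
  have h1 := hP.map_add [] [] a ((-c) • b)
  have h2 := hP.map_smul [] [] (-c) b
  simp only [List.nil_append] at h1 h2
  rw [sub_eq_add_neg, ← neg_smul, h1, h2, neg_smul, ← sub_eq_add_neg]

/-- The graded Jacobi identity of the big bracket, for homogeneous functions. -/
theorem rawBracket_jacobi (hσ : ∀ f, σ (σ f) = f) (l : List Ω) :
    ∀ {P Q R : List Ω → Ω} {p q r : ℝ}, (p = 1 ∨ p = -1) → (q = 1 ∨ q = -1) → (r = 1 ∨ r = -1) →
      IsFunction σ P → IsFunction σ Q → IsFunction σ R → parity σ P = p • P →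
      parity σ Q = q • Q → parity σ R = r • R →
      rawBracket σ (rawBracket σ P Q) R l = rawBracket σ P (rawBracket σ Q R) l
        + koszulSign q r • rawBracket σ (rawBracket σ P R) Q l := by
  induction l with
  | nil =>
    intro P Q R p q r hp hq hr hP hQ hR hPp hQq hRr
    have cP : σ (P []) = p • P [] := congrFun hPp []
    have cQ : σ (Q []) = q • Q [] := congrFun hQq []
    have cR : σ (R []) = r • R [] := congrFun hRr []
    -- On the zero section a double bracket only involves P, Q, R at one or two arguments built from
    -- `P []`, `Q []`, `R []`. The three swaps at the end put two-argument terms in a common order,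
    -- after which the identity is linear in the remaining terms.
    rw [rawBracket_nil_of_homogeneous (sign_mul hp hq) hr hR
        (parity_rawBracket_of_homogeneous hσ hP hQ hPp hQq) hRr,
      rawBracket_nil_of_homogeneous hp (sign_mul hq hr) (hQ.rawBracket hσ hR) hPp
        (parity_rawBracket_of_homogeneous hσ hQ hR hQq hRr),
      rawBracket_nil_of_homogeneous (sign_mul hp hr) hq hQ
        (parity_rawBracket_of_homogeneous hσ hP hR hPp hRr) hQq,
      rawBracket_singleton_of_homogeneous hσ hp hq hr hP hQ hPp hQq cR,
      rawBracket_singleton_of_homogeneous hσ hq hr hp hQ hR hQq hRr cP,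
      rawBracket_singleton_of_homogeneous hσ hp hr hq hP hR hPp hRr cQ,
      rawBracket_nil_of_homogeneous hp hq hQ hPp hQq,
      rawBracket_nil_of_homogeneous hq hr hR hQq hRr,
      rawBracket_nil_of_homogeneous hp hr hR hPp hRr,
      hP.apply_singleton_sub_smul, hQ.apply_singleton_sub_smul, hR.apply_singleton_sub_smul,
      hP.apply_pair_swap hr hq cR cQ, hQ.apply_pair_swap hr hp cR cP,
      hR.apply_pair_swap hq hp cQ cP]
    rcases hp with rfl | rfl <;> rcases hq with rfl | rfl <;> rcases hr with rfl | rfl <;>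
      simp only [koszulSign_one_left, koszulSign_one_right, koszulSign_neg_one_neg_one, mul_one,
        mul_neg, neg_neg] <;> module
  | cons f l ih =>
    intro P Q R p q r hp hq hr hP hQ hR hPp hQq hRr
    have hPQ := hP.rawBracket hσ hQ
    have hQR := hQ.rawBracket hσ hR
    have hPR := hP.rawBracket hσ hR
    have := eq_of_contr_homogeneous hσ (hPQ.rawBracket hσ hR)
      ((hP.rawBracket hσ hQR).add ((hPR.rawBracket hσ hQ).smul (koszulSign q r))) l
      (fun u f hu hf => ?_) f
    · exact this
    have e : contr (rawBracket σ P (rawBracket σ Q R)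
          + koszulSign q r • rawBracket σ (rawBracket σ P R) Q) f
        = contr (rawBracket σ P (rawBracket σ Q R)) f
          + koszulSign q r • contr (rawBracket σ (rawBracket σ P R) Q) f := rfl
    have hQRp := parity_rawBracket_of_homogeneous hσ hQ hR hQq hRr
    rw [e, contr_rawBracket_of_homogeneous hσ hr hu hPQ hR hRr hf,
      contr_rawBracket_of_homogeneous hσ (sign_mul hq hr) hu hP hQR hQRp hf,
      contr_rawBracket_of_homogeneous hσ hq hu hPR hQ hQq hf,
      contr_rawBracket_of_homogeneous hσ hq hu hP hQ hQq hf,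
      contr_rawBracket_of_homogeneous hσ hr hu hQ hR hRr hf,
      contr_rawBracket_of_homogeneous hσ hr hu hP hR hRr hf]
    -- As a sum of three terms, the contraction with f falls on R, on Q or on P; the identity is
    -- known for each of these triples on the shorter list.
    have i1 := ih hp hq (sign_mul hr hu) hP hQ (hR.contr f) hPp hQq (parity_contr hσ hR hRr hf)
    have i2 := ih hp (sign_mul hq hu) hr hP (hQ.contr f) hR hPp (parity_contr hσ hQ hQq hf) hRr
    have i3 := ih (sign_mul hp hu) hq hr (hP.contr f) hQ hR (parity_contr hσ hP hPp hf) hQq hRr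
    have sm : ∀ {A B C : List Ω → Ω} (c : ℝ), IsFunction σ C →
        rawBracket σ (A + c • B) C l = rawBracket σ A C l + c • rawBracket σ B C l :=
      fun c hC => by rw [rawBracket_add_left hσ l hC, rawBracket_smul_left hσ c l hC]
    have sm' : ∀ {A B C : List Ω → Ω} (c : ℝ), IsFunction σ A →
        rawBracket σ A (B + c • C) l = rawBracket σ A B l + c • rawBracket σ A C l :=
      fun c hA => by rw [rawBracket_add_right l hA, rawBracket_smul_right c l hA]
    simp only [Pi.add_apply, Pi.smul_apply, sm _ hR, sm _ hQ, sm' _ hP, i1, i2, i3]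
    rcases hq with rfl | rfl <;> rcases hr with rfl | rfl <;> rcases hu with rfl | rfl <;>
      simp only [koszulSign_one_left, koszulSign_one_right, koszulSign_neg_one_neg_one, mul_one,
        mul_neg, neg_neg] <;> module

end Jacobi

/-! ### Degrees of forms, momentum degree and shift of degree. -/

section Degree

variable {R : Type*} [CommRing R] {L : Type*} [AddCommGroup L] [Module R L]

variable (R L) in
/-- The forms of degree `m`, for an integer `m`; there are none but zero if `m` is negative. -/
noncomputable def formsDegree : ℤ → Submodule R (Forms R L)
  | .ofNat k => ⋀[R]^k (Module.Dual R L)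
  | .negSucc _ => ⊥

theorem mem_formsDegree_natCast {k : ℕ} {a : Forms R L} :
    a ∈ formsDegree R L k ↔ a ∈ ⋀[R]^k (Module.Dual R L) := Iff.rfl

theorem eq_zero_of_mem_formsDegree_neg {m : ℤ} (hm : m < 0) {a : Forms R L}
    (ha : a ∈ formsDegree R L m) : a = 0 := by
  cases m with
  | ofNat k => exact absurd hm (by simp)
  | negSucc k => exact ha

theorem mul_mem_formsDegree {m n p : ℤ} {a b : Forms R L} (ha : a ∈ formsDegree R L m)
    (hb : b ∈ formsDegree R L n) (hp : p = m + n) : a * b ∈ formsDegree R L p := by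
  subst hp
  rcases lt_or_ge m 0 with hm | hm
  · rw [eq_zero_of_mem_formsDegree_neg hm ha, zero_mul]; exact zero_mem _
  rcases lt_or_ge n 0 with hn | hn
  · rw [eq_zero_of_mem_formsDegree_neg hn hb, mul_zero]; exact zero_mem _
  lift m to ℕ using hm
  lift n to ℕ using hn
  rw [← Nat.cast_add, mem_formsDegree_natCast]
  exact SetLike.mul_mem_graded (A := fun k : ℕ => ⋀[R]^k (Module.Dual R L)) ha hb

theorem fn_mem_degree (f : R) : (fn f : Forms R L) ∈ ⋀[R]^0 (Module.Dual R L) := by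
  simp

theorem cov_mem_degree (α : Module.Dual R L) : cov α ∈ ⋀[R]^1 (Module.Dual R L) := by
  simp

/-- ⋀^k is the k-th power of the submodule of one-forms inside the exterior algebra, so induction on
powers by left multiplication applies. -/
theorem exteriorPower_induction
    {p : ∀ (k : ℕ) (a : Forms R L), a ∈ ⋀[R]^k (Module.Dual R L) → Prop}
    (hf : ∀ f, p 0 (fn f) (fn_mem_degree f))
    (ha : ∀ k a b ha hb, p k a ha → p k b hb → p k (a + b) (add_mem ha hb))
    (hm : ∀ (α : Module.Dual R L) k a ha, p k a ha → ∀ h, p (k + 1) (cov α * a) h)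
    {k : ℕ} {a : Forms R L} (h : a ∈ ⋀[R]^k (Module.Dual R L)) : p k a h := by
  induction h using Submodule.pow_induction_on_left' with
  | algebraMap r => exact hf r
  | add x y i hx hy px py => exact ha _ _ _ _ _ px py
  | mem_mul m hm' i x hx px =>
    obtain ⟨α, rfl⟩ := hm'
    exact hm α _ _ _ px _

theorem interior_mem_degree (X : L) {k : ℕ} {a : Forms R L}
    (h : a ∈ ⋀[R]^k (Module.Dual R L)) : interior X a ∈ formsDegree R L (k - 1) := by
  induction h using exteriorPower_induction with
  | hf f => rw [interior_fn]; exact zero_mem _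
  | ha k a b _ _ ha hb => rw [map_add]; exact add_mem ha hb
  | hm α k a ha ih _ =>
    rw [interior_cov_mul]
    refine sub_mem (Submodule.smul_mem _ _ ?_) ?_
    · rw [show ((k + 1 : ℕ) : ℤ) - 1 = k by push_cast; ring]; exact ha
    · exact mul_mem_formsDegree (m := (1 : ℕ)) (cov_mem_degree α) ih (by push_cast; ring)

theorem endDer_mem_degree (N : L →ₗ[R] L) {k : ℕ} {a : Forms R L}
    (h : a ∈ ⋀[R]^k (Module.Dual R L)) : endDer N a ∈ ⋀[R]^k (Module.Dual R L) := by
  induction h using exteriorPower_induction with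
  | hf f => rw [endDer_fn]; exact zero_mem _
  | ha k a b _ _ ha hb => rw [map_add]; exact add_mem ha hb
  | hm α k a ha ih _ =>
    rw [endDer_mul, endDer_cov, add_comm k 1]
    exact add_mem
      (SetLike.mul_mem_graded (A := fun k : ℕ => ⋀[R]^k (Module.Dual R L)) (cov_mem_degree _) ha)
      (SetLike.mul_mem_graded (A := fun k : ℕ => ⋀[R]^k (Module.Dual R L)) (cov_mem_degree _) ih)

variable [Algebra ℝ R] [Module ℝ L] [IsScalarTower ℝ R L]

theorem involution_of_mem_degree {k : ℕ} {a : Forms R L}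
    (h : a ∈ ⋀[R]^k (Module.Dual R L)) : involution R L a = (-1 : ℝ) ^ k • a := by
  induction h using exteriorPower_induction with
  | hf f => simp
  | ha k a b _ _ ha hb => rw [map_add, ha, hb, smul_add]
  | hm α k a ha ih _ =>
    rw [map_mul, ih, involution_cov, pow_succ, mul_neg_one, neg_smul, neg_mul, mul_smul_comm]

theorem involution_mem_formsDegree {m : ℤ} {a : Forms R L} (h : a ∈ formsDegree R L m) :
    involution R L a ∈ formsDegree R L m := by
  rcases lt_or_ge m 0 with hm | hm
  · rw [eq_zero_of_mem_formsDegree_neg hm h, map_zero]; exact zero_mem _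
  · lift m to ℕ using hm
    rw [involution_of_mem_degree h]
    exact Submodule.smul_of_tower_mem _ _ h

theorem evenPart_mem_formsDegree {m : ℤ} {a : Forms R L} (h : a ∈ formsDegree R L m) :
    evenPart (involution R L) a ∈ formsDegree R L m :=
  Submodule.smul_of_tower_mem _ _ (add_mem h (involution_mem_formsDegree h))

theorem oddPart_mem_formsDegree {m : ℤ} {a : Forms R L} (h : a ∈ formsDegree R L m) :
    oddPart (involution R L) a ∈ formsDegree R L m :=
  Submodule.smul_of_tower_mem _ _ (sub_mem h (involution_mem_formsDegree h))

/-- `P` is homogeneous of degree `ε` in the momenta. -/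
def HasMomentum {Ω : Type*} [Zero Ω] (P : List Ω → Ω) (ε : ℤ) : Prop :=
  ∀ l, (l.length : ℤ) ≠ ε → P l = 0

/-- `P` shifts the total degree of forms by `e`. -/
def HasShift (P : List (Forms R L) → Forms R L) (e : ℤ) : Prop :=
  ∀ (l : List (Forms R L)) (k : List ℕ),
    List.Forall₂ (fun f i => f ∈ ⋀[R]^i (Module.Dual R L)) l k → P l ∈ formsDegree R L (k.sum + e)

/-- With the shift δ - ε taken in ℤ and no forms in negative degree, the two clauses on degrees in
`HasBidegree` become a single membership, which is additive under the bracket. -/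
theorem hasBidegree_iff {P : List (Forms R L) → Forms R L} {ε δ : ℕ} :
    HasBidegree P ε δ ↔ HasMomentum P ε ∧ HasShift P (δ - ε) := by
  refine and_congr (by simp [HasMomentum]) (forall₂_congr fun l k => imp_congr_right fun _ => ?_)
  constructor
  · rintro ⟨h1, h2⟩
    rcases lt_or_ge (k.sum + δ) ε with h | h
    · rw [h2 h]; exact zero_mem _
    · have := h1 (k.sum + δ - ε) (by omega)
      rw [show (k.sum : ℤ) + (δ - ε) = (k.sum + δ - ε : ℕ) by omega]
      exact this
  · intro h
    refine ⟨fun m hm => ?_, fun hlt => eq_zero_of_mem_formsDegree_neg (by omega) h⟩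
    rw [show (k.sum : ℤ) + (δ - ε) = m by omega] at h
    exact h

theorem HasShift.contr {P : List (Forms R L) → Forms R L} {e : ℤ} (hP : HasShift P e) {k : ℕ}
    {f : Forms R L} (hf : f ∈ ⋀[R]^k (Module.Dual R L)) : HasShift (contr P f) (e + k) :=
  fun l ks h => by
    have := hP (f :: l) (k :: ks) (List.Forall₂.cons hf h)
    rw [List.sum_cons] at this
    rw [show (ks.sum : ℤ) + (e + k) = (k + ks.sum : ℕ) + e by push_cast; ring]
    exact this

theorem HasShift.parity {P : List (Forms R L) → Forms R L} {e : ℤ} (hP : HasShift P e) :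
    HasShift (parity (involution R L) P) e :=
  fun l k h => involution_mem_formsDegree <| hP _ _ <| by
    rw [List.forall₂_map_left_iff]
    exact List.Forall₂.imp (fun f i hf => involution_mem_formsDegree (m := (i : ℕ)) hf) h

/-- Integer degrees are needed here because the argument may itself be a value of a function, of
possibly negative degree; it is then zero. -/
theorem HasShift.apply_singleton {P : List (Forms R L) → Forms R L}
    (hPf : IsFunction (involution R L) P) {e m : ℤ} (hP : HasShift P e)
    {a : Forms R L} (ha : a ∈ formsDegree R L m) : P [a] ∈ formsDegree R L (m + e) := by
  rcases lt_or_ge m 0 with hm | hm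
  · rw [eq_zero_of_mem_formsDegree_neg hm ha, show P [0] = 0 from congrFun hPf.contr_zero []]
    exact zero_mem _
  · lift m to ℕ using hm
    simpa using hP [a] [m] (List.Forall₂.cons ha List.Forall₂.nil)

/-- Shifts add under the bracket: on the zero section P is applied to a value of Q or Q to a value
of P, and contraction with an i-form raises either shift by i. Passing to even or odd parts keeps
the degree. -/
theorem rawBracket_mem_formsDegree (l : List (Forms R L)) :
    ∀ {P Q : List (Forms R L) → Forms R L} {e e' : ℤ}, IsFunction (involution R L) P →
      IsFunction (involution R L) Q → HasShift P e → HasShift Q e' → ∀ k : List ℕ,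
        List.Forall₂ (fun f i => f ∈ ⋀[R]^i (Module.Dual R L)) l k →
          rawBracket (involution R L) P Q l ∈ formsDegree R L (k.sum + (e + e')) := by
  induction l with
  | nil =>
    rintro P Q e e' hPf hQf hP hQ _ ⟨⟩
    have h1 : P [] ∈ formsDegree R L e := by simpa using hP [] [] List.Forall₂.nil
    have h2 : Q [] ∈ formsDegree R L e' := by simpa using hQ [] [] List.Forall₂.nil
    simp only [List.sum_nil, Nat.cast_zero, zero_add]
    rw [rawBracket]
    refine sub_mem ?_ (add_mem (hQ.apply_singleton hQf (evenPart_mem_formsDegree h1))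
      (hQ.parity.apply_singleton (hQf.parity involution_involution) (oddPart_mem_formsDegree h1)))
    rw [add_comm]
    exact hP.apply_singleton hPf h2
  | cons f l ih =>
    rintro P Q e e' hPf hQf hP hQ _ (_ | ⟨hf, h⟩)
    rename_i i k
    have h1 := ih hPf (hQf.contr f) hP (hQ.contr hf) k h
    have h2 := ih (hPf.contr _) hQf (hP.contr (evenPart_mem_formsDegree (m := i) hf)) hQ k h
    have h3 := ih (hPf.contr _) (hQf.parity involution_involution)
      (hP.contr (oddPart_mem_formsDegree (m := i) hf)) hQ.parity k h
    rw [rawBracket, List.sum_cons]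
    have e1 : ((i + k.sum : ℕ) : ℤ) + (e + e') = k.sum + (e + (e' + i)) := by push_cast; ring
    have e2 : ((i + k.sum : ℕ) : ℤ) + (e + e') = k.sum + (e + i + e') := by push_cast; ring
    exact add_mem (add_mem (e1 ▸ h1) (e2 ▸ h2)) (e2 ▸ h3)

theorem HasMomentum.contr {Ω : Type*} [Zero Ω] {P : List Ω → Ω} {ε : ℤ} (hP : HasMomentum P ε)
    (f : Ω) : HasMomentum (contr P f) (ε - 1) := fun l hl =>
  hP (f :: l) (by push_cast [List.length_cons]; omega)

/-- The bracket uses up one momentum: each contraction lowers the momentum degree of P or Q by one,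
and on the zero section only degrees (1, 0) and (0, 1) contribute. -/
theorem rawBracket_eq_zero_of_momentum (l : List (Forms R L)) :
    ∀ {P Q : List (Forms R L) → Forms R L} {ε ε' : ℤ}, IsFunction (involution R L) P →
      IsFunction (involution R L) Q → HasMomentum P ε → HasMomentum Q ε' →
        (l.length : ℤ) ≠ ε + ε' - 1 → rawBracket (involution R L) P Q l = 0 := by
  induction l with
  | nil =>
    intro P Q ε ε' hPf hQf hP hQ hl
    have hp : HasMomentum (parity (involution R L) Q) ε' := fun l hl => by
      rw [SuperCotangent.parity, hQ _ (by simpa using hl), map_zero]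
    have z : ∀ {P : List (Forms R L) → Forms R L}, IsFunction (involution R L) P → P [0] = 0 :=
      fun hP => congrFun hP.contr_zero []
    simp only [List.length_nil, Nat.cast_zero] at hl
    rw [rawBracket]
    have h1 : P [Q []] = 0 := by
      -- If ε' = 0, the length condition excludes ε = 1 and P vanishes on singletons; otherwise `Q
      -- []` is zero.
      by_cases h : ε' = 0
      · exact hP _ (by simp; omega)
      · rw [hQ [] (by simpa using Ne.symm h), z hPf]
    rw [h1]
    by_cases h : ε = 0
    · rw [hQ [_] (by simp; omega), hp [_] (by simp; omega)]; simp
    · rw [hP [] (by simpa using Ne.symm h)]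
      simp [evenPart, oddPart, z hQf, z (hQf.parity involution_involution)]
  | cons f l ih =>
    intro P Q ε ε' hPf hQf hP hQ hl
    have hp : HasMomentum (parity (involution R L) Q) ε' := fun l hl => by
      rw [SuperCotangent.parity, hQ _ (by simpa using hl), map_zero]
    simp only [List.length_cons, Nat.cast_add, Nat.cast_one] at hl
    rw [rawBracket, ih hPf (hQf.contr f) hP (hQ.contr f) (by omega),
      ih (hPf.contr _) hQf (hP.contr _) hQ (by omega),
      ih (hPf.contr _) (hQf.parity involution_involution) (hP.contr _) hp (by omega)]
    simp

end Degree

/-! ### Determination by values on functions and one-forms. -/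

section Generators

variable {R : Type*} [CommRing R] {L : Type*} [AddCommGroup L] [Module R L]
  [Algebra ℝ R] [Module ℝ L] [IsScalarTower ℝ R L]

/-- `a` is a function or a one-form. -/
def IsGenerator (a : Forms R L) : Prop := (∃ f, a = fn f) ∨ ∃ α, a = cov α

/-- Frees one entry. The Leibniz rule is available in the last slot only, so f is moved past the
generators by graded symmetry until it stands there. -/
theorem apply_cons_eq_zero_of_generators (n : ℕ) :
    ∀ {P : List (Forms R L) → Forms R L}, IsFunction (involution R L) P →
      (∀ l : List (Forms R L), l.length = n + 1 → (∀ a ∈ l, IsGenerator a) → P l = 0) →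
      ∀ (f : Forms R L) (l : List (Forms R L)), l.length = n → (∀ a ∈ l, IsGenerator a) →
        P (f :: l) = 0 := by
  induction n with
  | zero =>
    intro P hP h f l hl _
    rw [List.length_eq_zero_iff.mp hl]
    have main : ∀ f, P [f] = 0 := by
      intro f
      have hfn : ∀ f, P [fn f] = 0 := fun f => h _ rfl (by simp [IsGenerator])
      have hcov : ∀ α, P [cov α] = 0 := fun α => h _ rfl (by simp [IsGenerator])
      -- The Leibniz rule for `a * b` also involves the value at the involution of b, so both values
      -- are carried through the induction.
      suffices P [f] = 0 ∧ P [involution R L f] = 0 from this.1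
      induction f using forms_induction with
      | hf f => rw [involution_fn]; exact ⟨hfn f, hfn f⟩
      | hc α =>
        refine ⟨hcov α, ?_⟩
        rw [involution_cov, show P [-cov α] = -P [cov α] from congrFun (hP.contr_neg _) [], hcov,
          neg_zero]
      | hm a b ha hb =>
        have l1 := hP.leibniz [] a b
        have l2 := hP.leibniz [] (involution R L a) (involution R L b)
        simp only [List.nil_append, involution_involution] at l1 l2
        rw [map_mul, l1, l2, ha.1, ha.2, hb.1, hb.2]; simp
      | ha a b ha hb =>
        have l1 := hP.map_add [] [] a b
        have l2 := hP.map_add [] [] (involution R L a) (involution R L b)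
        simp only [List.nil_append] at l1 l2
        rw [map_add, l1, l2, ha.1, ha.2, hb.1, hb.2]; simp
    exact main f
  | succ n ih =>
    rintro P hP h f (_ | ⟨g, l⟩) hl hg
    · simp at hl
    have hgen := hg g (by simp)
    have key : ∀ f, P (g :: f :: l) = 0 := fun f =>
      ih (hP.contr g) (fun l' hl' hg' => h (g :: l') (by simp [hl'])
        (by simpa using ⟨hgen, hg'⟩)) f l (by simpa using hl) (fun a ha => hg a (by simp [ha]))
    -- A function is even and passes f freely. A one-form is odd, so f is first split into its even
    -- and odd parts.
    rcases hgen with ⟨c, rfl⟩ | ⟨α, rfl⟩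
    · exact (hP.symm_even [] l (fn c) f (involution_fn c)).symm.trans (key f)
    · have e := hP.map_add [] (cov α :: l) (evenPart (involution R L) f)
        (oddPart (involution R L) f)
      have e0 := hP.symm_even [] l (evenPart (involution R L) f) (cov α)
        (apply_evenPart involution_involution f)
      have e1 := hP.symm_odd [] l (oddPart (involution R L) f) (cov α)
        (apply_oddPart involution_involution f) (involution_cov α)
      simp only [List.nil_append, evenPart_add_oddPart] at e e0 e1
      rw [e, e0, e1, key, key]; simp

/-- Contracting with an arbitrary head again gives a function that vanishes on lists of generators,
one entry shorter; so all entries are freed in turn. -/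
theorem eq_zero_of_generators (n : ℕ) :
    ∀ {P : List (Forms R L) → Forms R L}, IsFunction (involution R L) P →
      (∀ l : List (Forms R L), l.length = n → (∀ a ∈ l, IsGenerator a) → P l = 0) →
      ∀ l : List (Forms R L), l.length = n → P l = 0 := by
  induction n with
  | zero =>
    intro P _ h l hl
    exact h l hl (by simp [List.length_eq_zero_iff.mp hl])
  | succ n ih =>
    rintro P hP h (_ | ⟨f, l⟩) hl
    · simp at hl
    · exact ih (hP.contr f) (apply_cons_eq_zero_of_generators n hP h f) l (by simpa using hl)

/-- Functions on `T^*ΠA` are determined by their values on functions and one-forms. -/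
theorem CotangentFunctions.ext_generators {P Q : CotangentFunctions R L}
    (h : ∀ l : List (Forms R L), (∀ a ∈ l, IsGenerator a) → P l = Q l) : P = Q := by
  have hPQ : ∀ l, (P - Q).1 l = P l - Q l := fun l => rfl
  refine Subtype.ext (funext fun l => sub_eq_zero.mp ?_)
  rw [← hPQ]
  refine eq_zero_of_generators l.length (P - Q).2 (fun l' _ hl' => ?_) l rfl
  rw [hPQ, h l' hl', sub_self]

end Generators

/-! ### The big bracket of forms, (1,1)-tensors and bivectors. -/

section BigBracket

variable {R : Type*} [CommRing R] [Algebra ℝ R] {L : Type*} [AddCommGroup L] [Module R L]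
  [Module ℝ L] [IsScalarTower ℝ R L]

theorem CotangentFunctions.add_apply (P Q : CotangentFunctions R L) (l : List (Forms R L)) :
    (P + Q) l = P l + Q l := rfl

theorem CotangentFunctions.neg_apply (P : CotangentFunctions R L) (l : List (Forms R L)) :
    (-P) l = -P l := rfl

theorem CotangentFunctions.smul_apply (c : ℝ) (P : CotangentFunctions R L)
    (l : List (Forms R L)) : (c • P) l = c • P l := rfl

theorem bracket_add_right (P Q Q' : CotangentFunctions R L) : ⁅P, Q + Q'⁆ = ⁅P, Q⁆ + ⁅P, Q'⁆ :=
  Subtype.ext <| funext fun l => rawBracket_add_right l P.2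

theorem bracket_add_left (P P' Q : CotangentFunctions R L) : ⁅P + P', Q⁆ = ⁅P, Q⁆ + ⁅P', Q⁆ :=
  Subtype.ext <| funext fun l => rawBracket_add_left involution_involution l Q.2

theorem bracket_smul_right (c : ℝ) (P Q : CotangentFunctions R L) : ⁅P, c • Q⁆ = c • ⁅P, Q⁆ :=
  Subtype.ext <| funext fun l => rawBracket_smul_right c l P.2

theorem bracket_smul_left (c : ℝ) (P Q : CotangentFunctions R L) : ⁅c • P, Q⁆ = c • ⁅P, Q⁆ :=
  Subtype.ext <| funext fun l => rawBracket_smul_left involution_involution c l Q.2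

theorem bracket_neg_right (P Q : CotangentFunctions R L) : ⁅P, -Q⁆ = -⁅P, Q⁆ := by
  rw [show -Q = (-1 : ℝ) • Q by module, bracket_smul_right]; module

theorem bracket_neg_left (P Q : CotangentFunctions R L) : ⁅-P, Q⁆ = -⁅P, Q⁆ := by
  rw [show -P = (-1 : ℝ) • P by module, bracket_smul_left]; module

theorem bracket_zero_right (P : CotangentFunctions R L) : ⁅P, (0 : CotangentFunctions R L)⁆ = 0 := by
  simpa using bracket_smul_right 0 P 0

theorem bracket_zero_left (P : CotangentFunctions R L) : ⁅(0 : CotangentFunctions R L), P⁆ = 0 := by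
  simpa using bracket_smul_left 0 0 P

/-- `P` is homogeneous for the parity, with `s = (-1)^|P|`. -/
def HasParity (P : CotangentFunctions R L) (s : ℝ) : Prop :=
  (s = 1 ∨ s = -1) ∧ parity (involution R L) P = s • (P : List (Forms R L) → Forms R L)

theorem HasParity.bracket {P Q : CotangentFunctions R L} {s t : ℝ} (hP : HasParity P s)
    (hQ : HasParity Q t) : HasParity ⁅P, Q⁆ (s * t) :=
  ⟨sign_mul hP.1 hQ.1,
    parity_rawBracket_of_homogeneous involution_involution P.2 Q.2 hP.2 hQ.2⟩

theorem HasParity.add {P Q : CotangentFunctions R L} {s : ℝ} (hP : HasParity P s)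
    (hQ : HasParity Q s) : HasParity (P + Q) s :=
  ⟨hP.1, by
    rw [Submodule.coe_add, parity_add, hP.2, hQ.2, smul_add]⟩

theorem bracket_swap {P Q : CotangentFunctions R L} {s t : ℝ} (hP : HasParity P s)
    (hQ : HasParity Q t) : ⁅P, Q⁆ = -(koszulSign s t • ⁅Q, P⁆) :=
  Subtype.ext <| funext fun l =>
    rawBracket_swap involution_involution l hP.1 hQ.1 P.2 Q.2 hP.2 hQ.2

theorem bracket_swap_even {P Q : CotangentFunctions R L} {t : ℝ} (hP : HasParity P 1)
    (hQ : HasParity Q t) : ⁅P, Q⁆ = -⁅Q, P⁆ := by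
  rw [bracket_swap hP hQ, koszulSign_one_left, one_smul]

theorem bracket_swap_odd {P Q : CotangentFunctions R L} (hP : HasParity P (-1))
    (hQ : HasParity Q (-1)) : ⁅P, Q⁆ = ⁅Q, P⁆ := by
  rw [bracket_swap hP hQ, koszulSign_neg_one_neg_one]; module

/-- The bracket with an even function is a derivation of the big bracket. -/
theorem bracket_bracket_even {P Q T : CotangentFunctions R L} {s t : ℝ} (hP : HasParity P s)
    (hQ : HasParity Q t) (hT : HasParity T 1) :
    ⁅⁅P, Q⁆, T⁆ = ⁅P, ⁅Q, T⁆⁆ + ⁅⁅P, T⁆, Q⁆ :=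
  Subtype.ext <| funext fun l => by
    have := rawBracket_jacobi involution_involution l hP.1 hQ.1 hT.1 P.2 Q.2 T.2 hP.2 hQ.2 hT.2
    rw [koszulSign_one_right, one_smul] at this
    exact this

theorem CotangentFunctions.apply_singleton_zero (P : CotangentFunctions R L) : P [0] = 0 :=
  congrFun P.2.contr_zero []

/-- The contraction of a function with a form. -/
noncomputable def contraction (P : CotangentFunctions R L) (a : Forms R L) :
    CotangentFunctions R L := ⟨contr P a, P.2.contr a⟩

theorem contraction_apply (P : CotangentFunctions R L) (a : Forms R L) (l : List (Forms R L)) :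
    contraction P a l = P (a :: l) := rfl

theorem HasParity.contraction {P : CotangentFunctions R L} {s u : ℝ} (hP : HasParity P s)
    (hu : u = 1 ∨ u = -1) {a : Forms R L} (ha : involution R L a = u • a) :
    HasParity (contraction P a) (s * u) :=
  ⟨sign_mul hP.1 hu, parity_contr involution_involution P.2 hP.2 ha⟩

theorem contraction_bracket {P Q : CotangentFunctions R L} {t u : ℝ} (hQ : HasParity Q t)
    (hu : u = 1 ∨ u = -1) {a : Forms R L} (ha : involution R L a = u • a) :
    contraction ⁅P, Q⁆ a = ⁅P, contraction Q a⁆ + koszulSign u t • ⁅contraction P a, Q⁆ :=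
  Subtype.ext <|
    contr_rawBracket_of_homogeneous involution_involution hQ.1 hu P.2 Q.2 hQ.2 ha

theorem bracket_singleton {P Q : CotangentFunctions R L} {s t u : ℝ} (hP : HasParity P s)
    (hQ : HasParity Q t) (hu : u = 1 ∨ u = -1) {a : Forms R L} (ha : involution R L a = u • a) :
    ⁅P, Q⁆ [a] = P [Q [a]] - koszulSign s (t * u) • Q [a, P []]
      + koszulSign u t • (P [a, Q []] - koszulSign (s * u) t • Q [P [a]]) :=
  rawBracket_singleton_of_homogeneous involution_involution hP.1 hQ.1 hu P.2 Q.2 hP.2 hQ.2 ha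

theorem hasParity_ofForm {a : Forms R L} {s : ℝ} (hs : s = 1 ∨ s = -1)
    (ha : involution R L a = s • a) : HasParity (ofForm a) s := by
  refine ⟨hs, funext fun l => ?_⟩
  cases l with
  | nil => exact ha
  | cons f l => simp [parity, ofForm, rawForm]

theorem contraction_ofForm (a f : Forms R L) : contraction (ofForm a) f = 0 := rfl

/-- All contractions of a form vanish, so in the recursion only the term contracting P survives. Its
Koszul sign is cancelled by the sign for moving f past a. -/
theorem bracket_ofForm (P : CotangentFunctions R L) {a : Forms R L} {t : ℝ}
    (ht : t = 1 ∨ t = -1) (ha : involution R L a = t • a) :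
    ⁅P, ofForm a⁆ = contraction P a := by
  have main : ∀ (l : List (Forms R L)) (P : CotangentFunctions R L),
      ⁅P, ofForm a⁆ l = contraction P a l := by
    intro l
    induction l with
    | nil =>
      intro P
      have z : parity (involution R L) (rawForm a) [oddPart (involution R L) (P [])] = 0 := by
        simp [parity, rawForm]
      change P [a] - (0 + parity (involution R L) (rawForm a) [oddPart (involution R L) (P [])])
        = P [a]
      rw [z, add_zero, sub_zero]
    | cons f l ih =>
      intro P
      refine eq_of_contr_homogeneous involution_involution (Subtype.prop _) (Subtype.prop _) l
        (fun u f hu hf => ?_) f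
      change contraction ⁅P, ofForm a⁆ f l = P (a :: f :: l)
      rw [contraction_bracket (hasParity_ofForm ht ha) hu hf, contraction_ofForm,
        bracket_zero_right, zero_add, CotangentFunctions.smul_apply, ih, contraction_apply,
        contraction_apply, P.2.apply_pair_swap hu ht hf ha, smul_smul]
      rcases hu with rfl | rfl <;> rcases ht with rfl | rfl <;> norm_num [koszulSign]
  exact Subtype.ext <| funext fun l => main l P

theorem bracket_ofForm_ofForm (a : Forms R L) {b : Forms R L} {t : ℝ} (ht : t = 1 ∨ t = -1)
    (hb : involution R L b = t • b) : ⁅ofForm a, ofForm b⁆ = 0 := by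
  rw [bracket_ofForm _ ht hb, contraction_ofForm]

theorem eq_ofForm_of_momentum {P : CotangentFunctions R L} (hP : HasMomentum P.1 0) :
    P = ofForm (P []) :=
  Subtype.ext <| funext fun l => by
    cases l with
    | nil => rfl
    | cons f l => exact hP _ (by simp; omega)

theorem HasMomentum.bracket {P Q : CotangentFunctions R L} {ε ε' ε'' : ℤ}
    (hP : HasMomentum P.1 ε) (hQ : HasMomentum Q.1 ε') (h : ε'' = ε + ε' - 1) :
    HasMomentum (⁅P, Q⁆ : CotangentFunctions R L).1 ε'' :=
  fun l hl => rawBracket_eq_zero_of_momentum l P.2 Q.2 hP hQ (h ▸ hl)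

theorem HasShift.bracket {P Q : CotangentFunctions R L} {e e' e'' : ℤ}
    (hP : HasShift P.1 e) (hQ : HasShift Q.1 e') (h : e'' = e + e') :
    HasShift (⁅P, Q⁆ : CotangentFunctions R L).1 e'' :=
  fun l k hl => h ▸ rawBracket_mem_formsDegree l P.2 Q.2 hP hQ k hl

theorem HasMomentum.add {P Q : CotangentFunctions R L} {ε : ℤ} (hP : HasMomentum P.1 ε)
    (hQ : HasMomentum Q.1 ε) : HasMomentum (P + Q).1 ε := fun l hl => by
  rw [CotangentFunctions.add_apply, hP l hl, hQ l hl, add_zero]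

theorem HasShift.add {P Q : CotangentFunctions R L} {e : ℤ} (hP : HasShift P.1 e)
    (hQ : HasShift Q.1 e) : HasShift (P + Q).1 e := fun l k hl =>
  add_mem (hP l k hl) (hQ l k hl)

theorem hasMomentum_ofForm (a : Forms R L) : HasMomentum (ofForm a).1 0 := fun l hl => by
  cases l with
  | nil => simp at hl
  | cons f l => rfl

theorem hasShift_ofForm {a : Forms R L} {k : ℕ} (ha : a ∈ ⋀[R]^k (Module.Dual R L)) :
    HasShift (ofForm a).1 k := by
  rintro _ _ (_ | ⟨_, _⟩)
  · rw [List.sum_nil, Nat.cast_zero, zero_add]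
    exact ha
  · exact zero_mem _

theorem ofEnd_singleton (N : L →ₗ[R] L) (a : Forms R L) : ofEnd N [a] = endDer N a := rfl

theorem ofBivector_pair (π : ⋀[R]^2 L) (a b : Forms R L) :
    ofBivector π [a, b] = bivectorPairing π a b := rfl

theorem hasMomentum_ofEnd (N : L →ₗ[R] L) : HasMomentum (ofEnd N).1 1 := fun l hl => by
  rcases l with _ | ⟨a, _ | ⟨b, l⟩⟩
  · rfl
  · simp at hl
  · rfl

theorem hasMomentum_ofBivector (π : ⋀[R]^2 L) : HasMomentum (ofBivector π).1 2 := fun l hl => by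
  rcases l with _ | ⟨a, _ | ⟨b, _ | ⟨c, l⟩⟩⟩
  · rfl
  · rfl
  · simp at hl
  · rfl

theorem hasShift_ofEnd (N : L →ₗ[R] L) : HasShift (ofEnd N).1 0 := by
  rintro _ _ (_ | ⟨ha, _ | ⟨hb, _⟩⟩)
  · exact zero_mem _
  · rw [List.sum_cons, List.sum_nil, add_zero, add_zero]
    exact endDer_mem_degree N ha
  · exact zero_mem _

theorem bivectorPairing_mem_degree (π : ⋀[R]^2 L) {i j : ℕ} {a b : Forms R L}
    (ha : a ∈ ⋀[R]^i (Module.Dual R L)) (hb : b ∈ ⋀[R]^j (Module.Dual R L)) :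
    bivectorPairing π a b ∈ formsDegree R L (i + j - 2) := by
  have ha' := involution_mem_formsDegree (mem_formsDegree_natCast.mpr ha)
  induction π using wedge_induction with
  | hw X Y =>
    rw [bivectorPairing_wedge]
    exact sub_mem
      (mul_mem_formsDegree (interior_mem_degree X ha') (interior_mem_degree Y hb) (by ring))
      (mul_mem_formsDegree (interior_mem_degree Y ha') (interior_mem_degree X hb) (by ring))
  | h0 => rw [map_zero]; exact zero_mem _
  | ha x y hx hy => rw [map_add]; exact add_mem hx hy
  | hs c x hx => rw [map_smul]; exact Submodule.smul_mem _ _ hx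

theorem hasShift_ofBivector (π : ⋀[R]^2 L) : HasShift (ofBivector π).1 (-2) := by
  rintro _ _ (_ | ⟨ha, _ | ⟨hb, _ | ⟨hc, _⟩⟩⟩)
  · exact zero_mem _
  · exact zero_mem _
  · rw [List.sum_cons, List.sum_cons, List.sum_nil, add_zero, Nat.cast_add, ← sub_eq_add_neg]
    exact bivectorPairing_mem_degree π ha hb
  · exact zero_mem _

theorem involution_bivectorPairing (π : ⋀[R]^2 L) (a b : Forms R L) :
    involution R L (bivectorPairing π a b)
      = bivectorPairing π (involution R L a) (involution R L b) := by
  induction π using wedge_induction with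
  | hw X Y =>
    simp only [bivectorPairing_wedge, map_sub, map_mul, involution_interior, neg_mul_neg]
  | h0 => simp
  | ha x y hx hy => simp only [map_add, LinearMap.add_apply, hx, hy]
  | hs c x hx => simp only [map_smul, LinearMap.smul_apply, involution_smul, hx]

theorem hasParity_ofBivector (π : ⋀[R]^2 L) : HasParity (ofBivector π) 1 := by
  refine ⟨Or.inl rfl, funext fun l => ?_⟩
  rcases l with _ | ⟨a, _ | ⟨b, _ | ⟨c, l⟩⟩⟩ <;>
    simp [parity, ofBivector, rawBider, involution_bivectorPairing, involution_involution]

theorem hasParity_ofEnd (N : L →ₗ[R] L) : HasParity (ofEnd N) 1 := by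
  refine ⟨Or.inl rfl, funext fun l => ?_⟩
  rcases l with _ | ⟨a, _ | ⟨b, l⟩⟩ <;>
    simp [parity, ofEnd, rawDer, involution_endDer, involution_involution]

/-- The minus sign is the factor (-1)^|α| in `bivectorPairing`. It agrees with {α, π} = π♯α, since π
is even and so {π, α} = -{α, π}. -/
theorem bivectorPairing_cov_left (π : ⋀[R]^2 L) (α : Module.Dual R L) (a : Forms R L) :
    bivectorPairing π (cov α) a = -interior (sharp π α) a := by
  induction π using wedge_induction with
  | hw X Y =>
    rw [bivectorPairing_wedge, involution_cov, sharp_wedge, map_neg, map_neg, interior_cov,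
      interior_cov, map_sub, map_smul, map_smul, neg_mul, neg_mul, ← Algebra.smul_def,
      ← Algebra.smul_def, LinearMap.sub_apply, LinearMap.smul_apply, LinearMap.smul_apply]
    abel
  | h0 => simp
  | ha x y hx hy => simp only [map_add, LinearMap.add_apply, hx, hy, neg_add]
  | hs c x hx => simp only [map_smul, LinearMap.smul_apply, hx, smul_neg]

theorem bivectorPairing_fn_left (π : ⋀[R]^2 L) (f : R) (a : Forms R L) :
    bivectorPairing π (fn f) a = 0 := by
  induction π using wedge_induction with
  | hw X Y => rw [bivectorPairing_wedge, involution_fn, interior_fn, interior_fn]; simp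
  | h0 => simp
  | ha x y hx hy => simp only [map_add, LinearMap.add_apply, hx, hy, add_zero]
  | hs c x hx => simp only [map_smul, LinearMap.smul_apply, hx, smul_zero]

theorem bivectorPairing_fn_right (π : ⋀[R]^2 L) (f : R) (a : Forms R L) :
    bivectorPairing π a (fn f) = 0 := by
  rw [← bivectorPairing_symm_even π _ _ (involution_fn f), bivectorPairing_fn_left]

/-- `{π, ω} = -N` for `N = π♯ ∘ ω₂♭`. -/
theorem bracket_ofBivector_ofForm (π : ⋀[R]^2 L) (ω₂ : ⋀[R]^2 (Module.Dual R L)) :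
    ⁅ofBivector π, ofForm (ω₂ : Forms R L)⁆ = -ofEnd (sharp π ∘ₗ flat ω₂) := by
  have hω₂ : involution R L (ω₂ : Forms R L) = ω₂ := by
    simpa using involution_of_mem_degree ω₂.2
  rw [bracket_ofForm _ (Or.inl rfl) (by rwa [one_smul])]
  refine CotangentFunctions.ext_generators fun l hl => ?_
  rw [contraction_apply, CotangentFunctions.neg_apply]
  rcases l with _ | ⟨a, _ | ⟨b, l⟩⟩
  · exact neg_zero.symm
  -- A two-form is even, so the pairing is symmetric here and the generator can be put first.
  · rw [ofBivector_pair, ofEnd_singleton, bivectorPairing_symm_even π _ _ hω₂]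
    rcases hl a (by simp) with ⟨f, rfl⟩ | ⟨α, rfl⟩
    · rw [bivectorPairing_fn_left, endDer_fn, neg_zero]
    · rw [bivectorPairing_cov_left, interior_coe, endDer_cov]
      congr 2
      -- The transpose of π♯ ∘ ω♭ is ω♭ ∘ π♯: skewness of π and of ω contribute one sign each.
      ext Y
      rw [LinearMap.comp_apply, LinearMap.comp_apply, dual_sharp, flat_skew]
  · exact neg_zero.symm

theorem bracket_ofEnd_ofForm (N : L →ₗ[R] L) {a : Forms R L} {t : ℝ} (ht : t = 1 ∨ t = -1)
    (ha : involution R L a = t • a) : ⁅ofEnd N, ofForm a⁆ = ofForm (endDer N a) := by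
  rw [bracket_ofForm _ ht ha]
  exact eq_ofForm_of_momentum ((hasMomentum_ofEnd N).contr a)

end BigBracket

/-! ### Identification of {π, μ} with μ_π and of {N, μ} + {π, H} with d_N^H. -/

section Hamiltonian

variable {R : Type*} [CommRing R] [Algebra ℝ R] {L : Type*} [AddCommGroup L] [Module R L]
  [Module ℝ L] [IsScalarTower ℝ R L]

theorem CotangentFunctions.apply_singleton_neg (P : CotangentFunctions R L) (a : Forms R L) :
    P [-a] = -P [a] := congrFun (P.2.contr_neg a) []

theorem CotangentFunctions.apply_pair_zero (P : CotangentFunctions R L) (a : Forms R L) :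
    P [a, 0] = 0 := CotangentFunctions.apply_singleton_zero (contraction P a)

/-- Such a function is a derivation raising the degree of forms by one, hence it reverses parity; it
suffices to see this on functions and one-forms. -/
theorem hasParity_of_bidegree_one_two {P : CotangentFunctions R L} (hP : HasBidegree P.1 1 2) :
    HasParity P (-1) := by
  obtain ⟨h1, h2⟩ := hasBidegree_iff.mp hP
  have hd : ∀ {k : ℕ} {a : Forms R L}, a ∈ ⋀[R]^k (Module.Dual R L) →
      P [a] ∈ ⋀[R]^(k + 1) (Module.Dual R L) := fun {k a} ha => by
    have := h2 [a] [k] (List.Forall₂.cons ha List.Forall₂.nil)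
    rwa [show ((([k] : List ℕ).sum : ℕ) : ℤ) + (((2 : ℕ) : ℤ) - ((1 : ℕ) : ℤ)) = ((k + 1 : ℕ) : ℤ) by
      simp] at this
  refine ⟨Or.inr rfl, ?_⟩
  suffices h : (⟨parity (involution R L) P, P.2.parity involution_involution⟩ :
      CotangentFunctions R L) = (-1 : ℝ) • P from congrArg Subtype.val h
  refine CotangentFunctions.ext_generators fun l hl => ?_
  rw [CotangentFunctions.smul_apply]
  change involution R L (P (l.map (involution R L))) = _
  by_cases hlen : l.length = 1
  · obtain ⟨a, rfl⟩ := List.length_eq_one_iff.mp hlen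
    rw [List.map_singleton]
    rcases hl a (by simp) with ⟨f, rfl⟩ | ⟨α, rfl⟩
    · rw [involution_fn, involution_of_mem_degree (hd (fn_mem_degree f))]; norm_num
    · rw [involution_cov, CotangentFunctions.apply_singleton_neg, map_neg,
        involution_of_mem_degree (hd (cov_mem_degree α))]; norm_num
  · rw [h1 _ (by simp; omega), h1 _ (by omega), map_zero, smul_zero]

/-- On vector fields the big bracket is the graded commutator, and i_N is even, so no sign appears.
-/
theorem bracket_ofEnd_singleton {P : CotangentFunctions R L} (hP : HasMomentum P.1 1)
    (hodd : HasParity P (-1)) (N : L →ₗ[R] L) {a : Forms R L} {u : ℝ} (hu : u = 1 ∨ u = -1)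
    (ha : involution R L a = u • a) : ⁅ofEnd N, P⁆ [a] = endDer N (P [a]) - P [endDer N a] := by
  rw [bracket_singleton (hasParity_ofEnd N) hodd hu ha, hP [] (by simp),
    hasMomentum_ofEnd N [] (by simp), CotangentFunctions.apply_pair_zero,
    CotangentFunctions.apply_pair_zero, ofEnd_singleton, ofEnd_singleton]
  rcases hu with rfl | rfl <;>
    simp only [koszulSign_one_left, koszulSign_neg_one_neg_one, mul_one, one_mul] <;> module

/-- `{{{π, P}, α}, b} = {{π, P α}, b} + L_{π♯α} b` for an odd vector field `P`. -/
theorem bracket_ofBivector_cov {P : CotangentFunctions R L} (hP : HasMomentum P.1 1)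
    (hodd : HasParity P (-1)) (π : ⋀[R]^2 L) (α : Module.Dual R L) {b : Forms R L} {u : ℝ}
    (hu : u = 1 ∨ u = -1) (hb : involution R L b = u • b) :
    ⁅ofBivector π, P⁆ [cov α, b]
      = bivectorPairing π (P [cov α]) b + lieDerivative P (sharp π α) b := by
  have hα : involution R L (cov α) = (-1 : ℝ) • cov α := by simp
  have hPα : involution R L (P [cov α]) = (1 : ℝ) • P [cov α] := by
    rw [show (1 : ℝ) = -1 * -1 by norm_num]
    exact congrFun (hodd.contraction (Or.inr rfl) hα).2 []
  -- P is linear in the momenta, so one contraction leaves a form. The term of the recursion in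
  -- which α meets P is therefore the contraction of π with the even form `P [cov α]`; the other
  -- term is the commutator of an interior product with P, a Lie derivative.
  have h1 : contraction P (cov α) = ofForm (P [cov α]) :=
    eq_ofForm_of_momentum (hP.contr (cov α))
  rw [← contraction_apply, contraction_bracket hodd (Or.inr rfl) hα, h1,
    bracket_ofForm _ (Or.inl rfl) hPα, CotangentFunctions.add_apply,
    CotangentFunctions.smul_apply, contraction_apply, ofBivector_pair,
    bracket_singleton ((hasParity_ofBivector π).contraction (Or.inr rfl) hα) hodd hu hb,
    hP [] (by simp), CotangentFunctions.apply_pair_zero, contraction_apply, contraction_apply,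
    hasMomentum_ofBivector π [cov α] (by simp), CotangentFunctions.apply_pair_zero,
    contraction_apply, ofBivector_pair, ofBivector_pair, bivectorPairing_cov_left,
    bivectorPairing_cov_left, CotangentFunctions.apply_singleton_neg, lieDerivative]
  rcases hu with rfl | rfl <;>
    simp only [koszulSign_one_left, koszulSign_one_right, koszulSign_neg_one_neg_one, mul_one,
        mul_neg, neg_neg] <;> module

namespace LieAlgebroid

variable {𝓐 : LieAlgebroid R L} {μ : CotangentFunctions R L}

theorem IsHamiltonian.hasMomentum (hμ : 𝓐.IsHamiltonian μ) : HasMomentum μ.1 1 :=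
  (hasBidegree_iff.mp hμ.bidegree).1

theorem IsHamiltonian.hasShift (hμ : 𝓐.IsHamiltonian μ) : HasShift μ.1 1 := by
  simpa using (hasBidegree_iff.mp hμ.bidegree).2

theorem IsHamiltonian.hasParity (hμ : 𝓐.IsHamiltonian μ) : HasParity μ (-1) :=
  hasParity_of_bidegree_one_two hμ.bidegree

theorem IsHamiltonian.apply_mem_degree (hμ : 𝓐.IsHamiltonian μ) {k : ℕ} {a : Forms R L}
    (ha : a ∈ ⋀[R]^k (Module.Dual R L)) : μ [a] ∈ ⋀[R]^(k + 1) (Module.Dual R L) := by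
  have := hμ.hasShift [a] [k] (List.Forall₂.cons ha List.Forall₂.nil)
  rwa [show ((([k] : List ℕ).sum : ℕ) : ℤ) + 1 = ((k + 1 : ℕ) : ℤ) by simp] at this

theorem IsHamiltonian.bracket_ofForm (hμ : 𝓐.IsHamiltonian μ) {a : Forms R L} {t : ℝ}
    (ht : t = 1 ∨ t = -1) (ha : involution R L a = t • a) :
    ⁅μ, ofForm a⁆ = ofForm (μ [a]) := by
  rw [SuperCotangent.bracket_ofForm _ ht ha]
  exact eq_ofForm_of_momentum (hμ.hasMomentum.contr a)

theorem IsHamiltonian.koszul_cov_fn (hμ : 𝓐.IsHamiltonian μ) (π : ⋀[R]^2 L)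
    (α : Module.Dual R L) (f : R) :
    ⁅ofBivector π, μ⁆ [cov α, fn f] = fn (𝓐.anchor (sharp π α) f) := by
  rw [bracket_ofBivector_cov hμ.hasMomentum hμ.hasParity π α (Or.inl rfl) (by simp),
    bivectorPairing_fn_right, lieDerivative, interior_fn, CotangentFunctions.apply_singleton_zero, hμ.apply_fn,
    zero_add, add_zero]

theorem IsHamiltonian.koszul_cov_cov (hμ : 𝓐.IsHamiltonian μ) (π : ⋀[R]^2 L)
    (α β : Module.Dual R L) :
    ⁅ofBivector π, μ⁆ [cov α, cov β] = interior (sharp π α) (μ [cov β])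
      - interior (sharp π β) (μ [cov α]) + μ [fn (β (sharp π α))] := by
  have h : involution R L (μ [cov α]) = μ [cov α] := by
    simpa using involution_of_mem_degree (hμ.apply_mem_degree (cov_mem_degree α))
  rw [bracket_ofBivector_cov hμ.hasMomentum hμ.hasParity π α (Or.inr rfl) (by simp),
    bivectorPairing_symm_even π _ _ h, bivectorPairing_cov_left, lieDerivative, interior_cov]
  abel

/-- Existence is the computation of {π, μ} on generators. For uniqueness, momentum degree two leaves
only pairs of generators, and the prescribed values together with the bidegree settle these. -/
theorem IsHamiltonian.isKoszulHamiltonian_iff (hμ : 𝓐.IsHamiltonian μ) (π : ⋀[R]^2 L)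
    (P : CotangentFunctions R L) :
    IsKoszulHamiltonian 𝓐 μ π P ↔ P = ⁅ofBivector π, μ⁆ := by
  have hK : IsKoszulHamiltonian 𝓐 μ π ⁅ofBivector π, μ⁆ := by
    refine ⟨hasBidegree_iff.mpr ⟨(hasMomentum_ofBivector π).bracket hμ.hasMomentum (by norm_num),
      (hasShift_ofBivector π).bracket hμ.hasShift (by norm_num)⟩, fun α β => ?_,
      hμ.koszul_cov_fn π⟩
    -- The two Lie derivatives contribute d(β(π♯α)) - d(α(π♯β)) = 2 d(β(π♯α)) by skewness of π; the
    -- last term of the Koszul bracket removes one copy.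
    rw [hμ.koszul_cov_cov, koszulBracket, lieDerivative, lieDerivative, interior_cov,
      interior_cov, dual_sharp π β α, fn, fn, map_neg, CotangentFunctions.apply_singleton_neg]
    abel
  refine ⟨fun hP => CotangentFunctions.ext_generators fun l hl => ?_, fun h => h ▸ hK⟩
  rcases l with _ | ⟨a, _ | ⟨b, _ | ⟨c, l⟩⟩⟩
  · rw [hP.bidegree.1 _ (by simp), hK.bidegree.1 _ (by simp)]
  · rw [hP.bidegree.1 _ (by simp), hK.bidegree.1 _ (by simp)]
  · rcases hl a (by simp) with ⟨f, rfl⟩ | ⟨α, rfl⟩ <;>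
      rcases hl b (by simp) with ⟨g, rfl⟩ | ⟨β, rfl⟩
    -- On two functions the value would have degree 0 + 0 + 1 - 2 = -1, so it is zero.
    · have h : List.Forall₂ (fun a i => a ∈ ⋀[R]^i (Module.Dual R L)) [fn f, fn g] [0, 0] :=
        .cons (fn_mem_degree f) (.cons (fn_mem_degree g) .nil)
      rw [(hP.bidegree.2 _ [0, 0] h).2 (by simp), (hK.bidegree.2 _ [0, 0] h).2 (by simp)]
    · have e := fun Q : CotangentFunctions R L =>
        Q.2.symm_even [] [] (fn f) (cov β) (involution_fn f)
      simp only [List.nil_append] at e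
      rw [e, e, hP.apply_cov_fn, hK.apply_cov_fn]
    · rw [hP.apply_cov_fn, hK.apply_cov_fn]
    · rw [hP.apply_cov_cov, hK.apply_cov_cov]
  · rw [hP.bidegree.1 _ (by simp), hK.bidegree.1 _ (by simp)]

/-- {N, μ} acts as the commutator i_N d - d i_N, and {π, H} kills functions and sends α to i_{π♯α}
H. As the momentum degree is one, single generators decide uniqueness. -/
theorem IsHamiltonian.isBackgroundDerivation_iff (hμ : 𝓐.IsHamiltonian μ) (π : ⋀[R]^2 L)
    (N : L →ₗ[R] L) {H : Forms R L} (hH : H ∈ ⋀[R]^3 (Module.Dual R L))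
    (P : CotangentFunctions R L) :
    IsBackgroundDerivation μ π N H P ↔ P = ⁅ofEnd N, μ⁆ + ⁅ofBivector π, ofForm H⁆ := by
  have hH' : involution R L H = (-1 : ℝ) • H := by
    rw [involution_of_mem_degree hH]; norm_num
  have hπ : ∀ a, ⁅ofBivector π, ofForm H⁆ [a] = bivectorPairing π H a := fun a => by
    rw [SuperCotangent.bracket_ofForm _ (Or.inr rfl) hH']; rfl
  have hδ : IsBackgroundDerivation μ π N H (⁅ofEnd N, μ⁆ + ⁅ofBivector π, ofForm H⁆) := by
    refine ⟨hasBidegree_iff.mpr ⟨?_, ?_⟩, fun f => ?_, fun α => ?_⟩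
    · exact ((hasMomentum_ofEnd N).bracket hμ.hasMomentum (by norm_num)).add
        ((hasMomentum_ofBivector π).bracket (hasMomentum_ofForm H) (by norm_num))
    · exact ((hasShift_ofEnd N).bracket hμ.hasShift (by norm_num)).add
        ((hasShift_ofBivector π).bracket (hasShift_ofForm hH) (by norm_num))
    · rw [CotangentFunctions.add_apply,
        bracket_ofEnd_singleton hμ.hasMomentum hμ.hasParity N (Or.inl rfl) (by simp), hπ,
        bivectorPairing_fn_right, add_zero, deformedDifferential]
    -- H and α are both odd, so exchanging them gives a sign, which cancels the one in
    -- `bivectorPairing_cov_left`.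
    · rw [CotangentFunctions.add_apply,
        bracket_ofEnd_singleton hμ.hasMomentum hμ.hasParity N (Or.inr rfl) (by simp), hπ,
        bivectorPairing_symm_odd π _ _ (by rw [hH', neg_one_smul]) (involution_cov α),
        bivectorPairing_cov_left, neg_neg, deformedDifferential]
  refine ⟨fun hP => CotangentFunctions.ext_generators fun l hl => ?_, fun h => h ▸ hδ⟩
  rcases l with _ | ⟨a, _ | ⟨b, l⟩⟩
  · rw [hP.bidegree.1 _ (by simp), hδ.bidegree.1 _ (by simp)]
  · rcases hl a (by simp) with ⟨f, rfl⟩ | ⟨α, rfl⟩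
    · rw [hP.apply_fn, hδ.apply_fn]
    · rw [hP.apply_cov, hδ.apply_cov]
  · rw [hP.bidegree.1 _ (by simp), hδ.bidegree.1 _ (by simp)]

end LieAlgebroid

end Hamiltonian

/-! ### The Schouten bracket as a derived bracket. -/

section Poisson

variable {R : Type*} [CommRing R] [Algebra ℝ R] {L : Type*} [AddCommGroup L] [Module R L]
  [Module ℝ L] [IsScalarTower ℝ R L]

/-- The bracket of an odd and an even function, quadratic in the momenta, on odd forms. -/
theorem bracket_triple {P Q : CotangentFunctions R L} (hP : HasParity P (-1))
    (hQ : HasParity Q 1) (hP2 : HasMomentum P.1 2) (hQ2 : HasMomentum Q.1 2) {a b c : Forms R L}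
    (ha : involution R L a = -a) (hb : involution R L b = -b) (hc : involution R L c = -c) :
    ⁅P, Q⁆ [a, b, c] = P [a, Q [b, c]] - P [b, Q [a, c]] + P [c, Q [a, b]]
      + (Q [a, P [b, c]] - Q [b, P [a, c]] + Q [c, P [a, b]]) := by
  have hs : (-1 : ℝ) = 1 ∨ (-1 : ℝ) = -1 := Or.inr rfl
  have ha' : involution R L a = (-1 : ℝ) • a := by rw [ha]; module
  have hb' : involution R L b = (-1 : ℝ) • b := by rw [hb]; module
  have hc' : involution R L c = (-1 : ℝ) • c := by rw [hc]; module
  have hPa := hP.contraction hs ha'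
  have hPb := hP.contraction hs hb'
  have hQa := hQ.contraction hs ha'
  have hQb := hQ.contraction hs hb'
  have z3 : ∀ {T : CotangentFunctions R L} (_ : HasMomentum T.1 2) (x y z : Forms R L),
      T [x, y, z] = 0 := fun hT x y z => hT _ (by simp)
  have z1 : ∀ {T : CotangentFunctions R L} (_ : HasMomentum T.1 2) (x : Forms R L),
      T [x] = 0 := fun hT x => hT _ (by simp)
  have zz : ∀ (T : CotangentFunctions R L) (x y : Forms R L), T [x, y, 0] = 0 := fun T x y =>
    CotangentFunctions.apply_singleton_zero (contraction (contraction T x) y)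
  -- Contracting with a and then b distributes these two forms over P and Q, which leaves four
  -- brackets to evaluate at c. Both functions are quadratic in the momenta, so only terms where
  -- each has exactly two arguments survive: six in all.
  rw [← contraction_apply, contraction_bracket hQ hs ha', CotangentFunctions.add_apply,
    CotangentFunctions.smul_apply, ← contraction_apply ⁅P, contraction Q a⁆,
    ← contraction_apply ⁅contraction P a, Q⁆,
    contraction_bracket hQa hs hb', contraction_bracket hQ hs hb',
    CotangentFunctions.add_apply, CotangentFunctions.smul_apply,
    CotangentFunctions.add_apply, CotangentFunctions.smul_apply,
    bracket_singleton hP (hQa.contraction hs hb') hs hc',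
    bracket_singleton hPb hQa hs hc', bracket_singleton hPa hQb hs hc',
    bracket_singleton (hPa.contraction hs hb') hQ hs hc']
  simp only [contraction_apply, z3 hP2, z3 hQ2, z1 hP2, z1 hQ2, zz, hP2 [] (by simp),
    hQ2 [] (by simp), CotangentFunctions.apply_singleton_zero, CotangentFunctions.apply_pair_zero,
    koszulSign_one_left, koszulSign_one_right, koszulSign_neg_one_neg_one, mul_one, one_mul,
    mul_neg, neg_neg]
  module

/-- The evaluation of a trivector on three one-forms, extended by zero to other degrees. -/
noncomputable def tripleContraction (α β γ : Module.Dual R L) : ExteriorAlgebra R L →ₗ[R] R :=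
  (ExteriorAlgebra.algebraMapInv (R := R) (M := L)).toLinearMap ∘ₗ
    CliffordAlgebra.contractLeft (Q := (0 : QuadraticForm R L)) γ ∘ₗ
    CliffordAlgebra.contractLeft (Q := (0 : QuadraticForm R L)) β ∘ₗ
    CliffordAlgebra.contractLeft (Q := (0 : QuadraticForm R L)) α

theorem tripleContraction_ι_mul_ι_mul_ι (α β γ : Module.Dual R L) (X Y Z : L) :
    tripleContraction α β γ
      (ExteriorAlgebra.ι R X * ExteriorAlgebra.ι R Y * ExteriorAlgebra.ι R Z)
      = α X * (β Y * γ Z - β Z * γ Y) - α Y * (β X * γ Z - β Z * γ X)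
        + α Z * (β X * γ Y - β Y * γ X) := by
  have h1 : ∀ (δ : Module.Dual R L) (X : L) (b : ExteriorAlgebra R L),
      CliffordAlgebra.contractLeft (Q := (0 : QuadraticForm R L)) δ (ExteriorAlgebra.ι R X * b)
        = δ X • b - ExteriorAlgebra.ι R X *
          CliffordAlgebra.contractLeft (Q := (0 : QuadraticForm R L)) δ b :=
    fun δ X b => CliffordAlgebra.contractLeft_ι_mul _ _ _
  have h2 : ∀ (δ : Module.Dual R L) (X : L),
      CliffordAlgebra.contractLeft (Q := (0 : QuadraticForm R L)) δ (ExteriorAlgebra.ι R X)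
        = algebraMap R _ (δ X) := fun δ X => CliffordAlgebra.contractLeft_ι _ _ _
  have h3 : ∀ (δ : Module.Dual R L) (r : R),
      CliffordAlgebra.contractLeft (Q := (0 : QuadraticForm R L)) δ
        (algebraMap R (ExteriorAlgebra R L) r) = 0 :=
    fun δ r => CliffordAlgebra.contractLeft_algebraMap _ _ _
  have h4 : ∀ r : R, ExteriorAlgebra.algebraMapInv (algebraMap R (ExteriorAlgebra R L) r) = r :=
    ExteriorAlgebra.algebraMap_leftInverse L
  simp only [tripleContraction, LinearMap.comp_apply, mul_assoc, h1, h2, map_sub, map_smul,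
    h3, mul_zero, smul_zero, sub_zero, AlgHom.toLinearMap_apply, h4, smul_eq_mul]
  ring

namespace LieAlgebroid

variable {𝓐 : LieAlgebroid R L} {μ : CotangentFunctions R L}

theorem bracket_swap (𝓐 : LieAlgebroid R L) (X Y : L) : 𝓐.bracket X Y = -𝓐.bracket Y X := by
  have h := 𝓐.bracket_self (X + Y)
  simp only [map_add, LinearMap.add_apply, 𝓐.bracket_self, zero_add, add_zero] at h
  exact eq_neg_of_add_eq_zero_left (by rw [← h]; abel)

theorem bracket_smul_left (𝓐 : LieAlgebroid R L) (f : R) (X Y : L) :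
    𝓐.bracket (f • X) Y = f • 𝓐.bracket X Y - 𝓐.anchor Y f • X := by
  rw [𝓐.bracket_swap, 𝓐.leibniz, 𝓐.bracket_swap Y X]
  module

theorem IsHamiltonian.interior_koszul (hμ : 𝓐.IsHamiltonian μ) (π : ⋀[R]^2 L)
    (α β : Module.Dual R L) (Z : L) :
    interior Z (⁅ofBivector π, μ⁆ [cov α, cov β]) =
      fn (𝓐.anchor (sharp π α) (β Z) - 𝓐.anchor Z (β (sharp π α)) - β (𝓐.bracket (sharp π α) Z)
        - (𝓐.anchor (sharp π β) (α Z) - 𝓐.anchor Z (α (sharp π β))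
          - α (𝓐.bracket (sharp π β) Z)) + 𝓐.anchor Z (β (sharp π α))) := by
  rw [hμ.koszul_cov_cov, map_add, map_sub, hμ.apply_cov, hμ.apply_cov, hμ.apply_fn, fn, fn, fn, fn,
    ← map_sub, ← map_add]

/-- {{π, μ}, π'} is the derived bracket, which on bivectors is the Schouten bracket up to sign. The
identity is stated for wedges because `schoutenWedge` is defined on representatives; sums are
handled by biadditivity. -/
theorem IsHamiltonian.triple_eq (hμ : 𝓐.IsHamiltonian μ) (X Y X' Y' : L)
    (α β γ : Module.Dual R L) :
    ⁅⁅ofBivector (wedge X Y : ⋀[R]^2 L), μ⁆, ofBivector (wedge X' Y')⁆ [cov α, cov β, cov γ]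
      = fn (-tripleContraction α β γ (𝓐.schoutenWedge X Y X' Y')) := by
  have h1 : ∀ α β : Module.Dual R L, ofBivector (wedge X' Y' : ⋀[R]^2 L) [cov α, cov β]
      = fn (-(β (sharp (wedge X' Y') α))) := fun α β => by
    rw [ofBivector_pair, bivectorPairing_cov_left, interior_cov, fn, fn, map_neg]
  have h2 : ∀ α β γ : Module.Dual R L, ofBivector (wedge X' Y' : ⋀[R]^2 L)
      [cov α, ⁅ofBivector (wedge X Y : ⋀[R]^2 L), μ⁆ [cov β, cov γ]] =
      fn (-(𝓐.anchor (sharp (wedge X Y) β) (γ (sharp (wedge X' Y') α))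
        - 𝓐.anchor (sharp (wedge X' Y') α) (γ (sharp (wedge X Y) β))
        - γ (𝓐.bracket (sharp (wedge X Y) β) (sharp (wedge X' Y') α))
        - (𝓐.anchor (sharp (wedge X Y) γ) (β (sharp (wedge X' Y') α))
          - 𝓐.anchor (sharp (wedge X' Y') α) (β (sharp (wedge X Y) γ))
          - β (𝓐.bracket (sharp (wedge X Y) γ) (sharp (wedge X' Y') α)))
        + 𝓐.anchor (sharp (wedge X' Y') α) (γ (sharp (wedge X Y) β)))) := fun α β γ => by
    rw [ofBivector_pair, bivectorPairing_cov_left, hμ.interior_koszul, fn, fn, map_neg]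
  rw [bracket_triple (by simpa using (hasParity_ofBivector _).bracket hμ.hasParity)
    (hasParity_ofBivector _)
    ((hasMomentum_ofBivector _).bracket hμ.hasMomentum (by norm_num)) (hasMomentum_ofBivector _)
    (involution_cov α) (involution_cov β) (involution_cov γ)]
  simp only [h1, h2, hμ.koszul_cov_fn]
  simp only [fn, ← map_add, ← map_sub]
  congr 1
  simp only [schoutenWedge, map_add, map_sub, tripleContraction_ι_mul_ι_mul_ι]
  -- With π♯α = α(X)Y - α(Y)X the brackets acquire function coefficients. After the Leibniz rules
  -- all terms where an anchor differentiates a pairing cancel, leaving the pairings with the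
  -- brackets of X, Y with X', Y'.
  simp only [sharp_wedge, map_sub, map_smul, map_neg, LinearMap.sub_apply,
    𝓐.leibniz, 𝓐.bracket_smul_left, Derivation.coe_sub, Derivation.coe_smul, Pi.sub_apply,
    Pi.smul_apply, Derivation.leibniz, smul_eq_mul, map_add]
  ring

end LieAlgebroid

end Poisson

/-! ### The Poisson condition, the two twists and the structure equation. -/

section Main

variable {R : Type*} [CommRing R] [Algebra ℝ R] {L : Type*} [AddCommGroup L] [Module R L]
  [Module ℝ L] [IsScalarTower ℝ R L]

theorem bracket_sum_left {ι : Type*} (s : Finset ι) (P : ι → CotangentFunctions R L)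
    (Q : CotangentFunctions R L) : ⁅∑ i ∈ s, P i, Q⁆ = ∑ i ∈ s, ⁅P i, Q⁆ := by
  classical
  induction s using Finset.induction_on with
  | empty => simp [bracket_zero_left]
  | insert a s ha ih => rw [Finset.sum_insert ha, Finset.sum_insert ha, bracket_add_left, ih]

theorem bracket_sum_right {ι : Type*} (s : Finset ι) (P : CotangentFunctions R L)
    (Q : ι → CotangentFunctions R L) : ⁅P, ∑ i ∈ s, Q i⁆ = ∑ i ∈ s, ⁅P, Q i⁆ := by
  classical
  induction s using Finset.induction_on with
  | empty => simp [bracket_zero_right]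
  | insert a s ha ih => rw [Finset.sum_insert ha, Finset.sum_insert ha, bracket_add_right, ih]

theorem CotangentFunctions.sum_apply {ι : Type*} (s : Finset ι) (P : ι → CotangentFunctions R L)
    (l : List (Forms R L)) : (∑ i ∈ s, P i) l = ∑ i ∈ s, P i l := by
  rw [Submodule.coe_sum, Finset.sum_apply]

theorem ofBivector_add (π π' : ⋀[R]^2 L) :
    ofBivector (π + π') = ofBivector π + ofBivector π' :=
  Subtype.ext <| funext fun l => by
    rcases l with _ | ⟨a, _ | ⟨b, _ | ⟨c, l⟩⟩⟩ <;> simp [ofBivector, rawBider]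

theorem ofBivector_zero : ofBivector (0 : ⋀[R]^2 L) = 0 := by
  simpa using ofBivector_add (0 : ⋀[R]^2 L) 0

theorem ofBivector_sum {ι : Type*} (s : Finset ι) (π : ι → ⋀[R]^2 L) :
    ofBivector (∑ i ∈ s, π i) = ∑ i ∈ s, ofBivector (π i) := by
  classical
  induction s using Finset.induction_on with
  | empty => simp [ofBivector_zero]
  | insert a s ha ih => rw [Finset.sum_insert ha, Finset.sum_insert ha, ofBivector_add, ih]

theorem twist_eq_sum {τ P : CotangentFunctions R L} {n : ℕ}
    (h : ∀ k ≥ n, (fun Q : CotangentFunctions R L => ⁅Q, τ⁆)^[k] P = 0) :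
    twist τ P = ∑ k ∈ Finset.range n,
      ((k.factorial : ℝ)⁻¹) • (fun Q : CotangentFunctions R L => ⁅Q, τ⁆)^[k] P := by
  refine finsum_eq_sum_of_support_subset _ fun k hk => ?_
  by_contra hn
  simp only [Finset.coe_range, Set.mem_Iio, not_lt] at hn
  exact hk (by simp only [h k hn, smul_zero])

theorem iterate_bracket_eq_zero {τ P : CotangentFunctions R L} {n : ℕ}
    (h : (fun Q : CotangentFunctions R L => ⁅Q, τ⁆)^[n] P = 0) :
    ∀ k ≥ n, (fun Q : CotangentFunctions R L => ⁅Q, τ⁆)^[k] P = 0 := by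
  intro k hk
  induction k, hk using Nat.le_induction with
  | base => exact h
  | succ k _ ih => rw [Function.iterate_succ_apply', ih, bracket_zero_left]

namespace LieAlgebroid

variable {𝓐 : LieAlgebroid R L} {μ : CotangentFunctions R L}

theorem IsHamiltonian.hasParity_bracket (hμ : 𝓐.IsHamiltonian μ) (π : ⋀[R]^2 L) :
    HasParity ⁅ofBivector π, μ⁆ (-1) := by
  simpa using (hasParity_ofBivector π).bracket hμ.hasParity

/-- A Poisson bivector satisfies `{{π, μ}, π} = 0`. -/
theorem IsHamiltonian.bracket_bracket_of_isPoisson (hμ : 𝓐.IsHamiltonian μ) {π : ⋀[R]^2 L}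
    (hπ : 𝓐.IsPoisson π) : ⁅⁅ofBivector π, μ⁆, ofBivector π⁆ = 0 := by
  have hm : HasMomentum (⁅⁅ofBivector π, μ⁆, ofBivector π⁆ : CotangentFunctions R L).1 3 :=
    ((hasMomentum_ofBivector π).bracket hμ.hasMomentum (by norm_num)).bracket
      (hasMomentum_ofBivector π) (ε := 2) (by norm_num)
  -- With momentum degree three and shift -3, three generators of degree at most one give a possibly
  -- nonzero value only when all of them are one-forms.
  have hs : HasShift (⁅⁅ofBivector π, μ⁆, ofBivector π⁆ : CotangentFunctions R L).1 (-3) :=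
    ((hasShift_ofBivector π).bracket hμ.hasShift (by norm_num)).bracket
      (hasShift_ofBivector π) (e := -1) (by norm_num)
  refine CotangentFunctions.ext_generators fun l hl => ?_
  change _ = (0 : Forms R L)
  by_cases hlen : l.length = 3
  swap
  · exact hm l (by exact_mod_cast hlen)
  obtain ⟨a, b, c, rfl⟩ := List.length_eq_three.mp hlen
  have hk : ∀ {x : Forms R L}, IsGenerator x → ∃ k : ℕ, k ≤ 1 ∧
      x ∈ ⋀[R]^k (Module.Dual R L) ∧ (k = 1 → ∃ α, x = cov α) := by
    rintro x (⟨f, rfl⟩ | ⟨α, rfl⟩)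
    · exact ⟨0, by omega, fn_mem_degree f, by omega⟩
    · exact ⟨1, le_rfl, cov_mem_degree α, fun _ => ⟨α, rfl⟩⟩
  obtain ⟨i, hi, hai, ha⟩ := hk (hl a (by simp))
  obtain ⟨j, hj, hbj, hb⟩ := hk (hl b (by simp))
  obtain ⟨k, hk, hck, hc⟩ := hk (hl c (by simp))
  by_cases hsum : i + j + k = 3
  swap
  · refine eq_zero_of_mem_formsDegree_neg ?_ (hs [a, b, c] [i, j, k]
      (.cons hai (.cons hbj (.cons hck .nil))))
    simp only [List.sum_cons, List.sum_nil]
    omega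
  obtain ⟨α, rfl⟩ := ha (by omega)
  obtain ⟨β, rfl⟩ := hb (by omega)
  obtain ⟨γ, rfl⟩ := hc (by omega)
  obtain ⟨n, X, Y, rfl, h⟩ := hπ
  simp only [ofBivector_sum, bracket_sum_left, bracket_sum_right, CotangentFunctions.sum_apply,
    hμ.triple_eq]
  simp only [fn, map_neg, ← map_sum, Finset.sum_neg_distrib]
  -- The order of summation is exchanged to match the double sum from expanding the outer and inner
  -- brackets.
  rw [Finset.sum_comm] at h
  rw [h]
  simp

/-- Bracketing {μ, μ} = 0 with π gives 2{K, μ} = 0 for K = {π, μ}. Bracketing {K, μ} = 0 with π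
again gives {K, K} = 0, because {K, π} = 0. -/
theorem IsHamiltonian.bracket_self_of_isPoisson (hμ : 𝓐.IsHamiltonian μ) {π : ⋀[R]^2 L}
    (hπ : 𝓐.IsPoisson π) :
    ⁅(⁅ofBivector π, μ⁆ : CotangentFunctions R L), ⁅ofBivector π, μ⁆⁆ = 0 := by
  have hK := hμ.hasParity_bracket π
  have hπe := hasParity_ofBivector π
  have h0 := hμ.bracket_bracket_of_isPoisson hπ
  have hsw := SuperCotangent.bracket_swap_even hπe hμ.hasParity
  set K : CotangentFunctions R L := ⁅ofBivector π, μ⁆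
  have hsw' : ⁅μ, ofBivector π⁆ = -K := by rw [hsw, neg_neg]
  have e1 := bracket_bracket_even hμ.hasParity hμ.hasParity hπe
  rw [hμ.bracket_self_eq_zero, bracket_zero_left, hsw', bracket_neg_left, bracket_neg_right,
    bracket_swap_odd hμ.hasParity hK] at e1
  have e2 : ⁅K, μ⁆ = 0 := by
    have : ⁅K, μ⁆ = (-2⁻¹ : ℝ) • (-⁅K, μ⁆ + -⁅K, μ⁆) := by module
    rw [this, ← e1, smul_zero]
  have e3 := bracket_bracket_even hK hμ.hasParity hπe
  rw [e2, bracket_zero_left, hsw', h0, bracket_zero_left, bracket_neg_right, add_zero] at e3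
  exact neg_eq_zero.mp e3.symm

end LieAlgebroid

/-- The exponential of the bracket with an even function preserves `{P, P} = 0`. -/
theorem bracket_self_eq_zero_of_twist {P Q T V : CotangentFunctions R L} (hP : HasParity P (-1))
    (hQ : HasParity Q (-1)) (hT : HasParity T (-1)) (hV : HasParity V 1)
    (h0 : ⁅P, P⁆ = 0) (h1 : ⁅P, V⁆ = -Q) (h2 : ⁅Q, V⁆ = (-2 : ℝ) • T) (h3 : ⁅T, V⁆ = 0)
    (h4 : ⁅T, T⁆ = 0) : ⁅P + Q + T, P + Q + T⁆ = 0 := by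
  -- Bracketing with V is a derivation. Applied to {P, P}, {P, Q}, {P, T} and {Q, Q} it yields {P,
  -- Q} = 0, {Q, Q} = -2{P, T}, {{P, T}, V} = -{Q, T} and {{Q, Q}, V} = -4{Q, T}.
  have e1 := bracket_bracket_even hP hP hV
  have e2 := bracket_bracket_even hP hQ hV
  have e3 := bracket_bracket_even hP hT hV
  have e4 := bracket_bracket_even hQ hQ hV
  simp only [h0, h1, h2, h3, bracket_zero_left, bracket_zero_right, bracket_neg_left,
    bracket_neg_right, bracket_smul_left, bracket_smul_right, zero_add,
    bracket_swap_odd hQ hP, bracket_swap_odd hT hQ] at e1 e2 e3 e4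
  have f1 : ⁅P, Q⁆ = 0 := by
    have : ⁅P, Q⁆ = (-2⁻¹ : ℝ) • (-⁅P, Q⁆ + -⁅P, Q⁆) := by module
    rw [this, ← e1, smul_zero]
  rw [f1, bracket_zero_left] at e2
  have f2 : ⁅Q, Q⁆ = (-2 : ℝ) • ⁅P, T⁆ := by
    have : ⁅Q, Q⁆ = (-2 : ℝ) • ⁅P, T⁆ - ((-2 : ℝ) • ⁅P, T⁆ + -⁅Q, Q⁆) := by module
    rw [this, ← e2, sub_zero]
  rw [f2, bracket_smul_left, e3] at e4
  -- Two values of {{Q, Q}, V} are compared, 2{Q, T} through {Q, Q} = -2{P, T} and -4{Q, T}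
  -- directly; hence 6{Q, T} = 0.
  have f3 : ⁅Q, T⁆ = 0 := by
    have : ⁅Q, T⁆ = (6⁻¹ : ℝ) • ((-2 : ℝ) • -⁅Q, T⁆
        - ((-2 : ℝ) • ⁅Q, T⁆ + (-2 : ℝ) • ⁅Q, T⁆)) := by module
    rw [this, e4, sub_self, smul_zero]
  simp only [bracket_add_left, bracket_add_right, bracket_swap_odd hQ hP, bracket_swap_odd hT hQ,
    bracket_swap_odd hT hP, h0, f1, f2, f3, h4]
  module

theorem ofForm_add (a b : Forms R L) : ofForm (a + b) = ofForm a + ofForm b :=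
  Subtype.ext <| funext fun l => by cases l <;> simp [ofForm, rawForm]

theorem ofForm_smul (c : ℝ) (a : Forms R L) : ofForm (c • a) = c • ofForm a :=
  Subtype.ext <| funext fun l => by cases l <;> simp [ofForm, rawForm]

theorem ofForm_neg (a : Forms R L) : ofForm (-a) = -ofForm a :=
  Subtype.ext <| funext fun l => by cases l <;> simp [ofForm, rawForm]

/-- The algebraic form of the theorem, for a commutative ℝ-algebra R and an R-module L in place of
smooth functions and sections. -/
theorem twist_poisson_two_form (𝓐 : LieAlgebroid R L) (μ : CotangentFunctions R L)
    (hμ : 𝓐.IsHamiltonian μ) (π : ⋀[R]^2 L) (hπ : 𝓐.IsPoisson π)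
    (ω₂ : ⋀[R]^2 (Module.Dual R L)) :
    let N := sharp π ∘ₗ flat ω₂
    let ψ := μ [omegaN ω₂ N]
    let H := -μ [(ω₂ : Forms R L)]
    let S := inducedStructure μ π N ψ H
    let πf := ofBivector π
    let ωf := ofForm (ω₂ : Forms R L)
    ∃ μπ δ : CotangentFunctions R L,
      (∀ P, IsKoszulHamiltonian 𝓐 μ π P ↔ P = μπ) ∧ ⁅μπ, μπ⁆ = 0 ∧
      (∀ P, IsBackgroundDerivation μ π N H P ↔ P = δ) ∧
      S = μπ + δ + ofForm (ψ + endDer N H) ∧ ⁅S, S⁆ = 0 ∧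
      TwistTerminates (-πf) μ ∧ TwistTerminates (-ωf) (twist (-πf) μ - μ) ∧
      S = twist (-ωf) (twist (-πf) μ - μ) ∧
      twist (-πf) μ - μ = μπ ∧ S = twist (-ωf) μπ := by
  intro N ψ H S πf ωf
  have hω : (ω₂ : Forms R L) ∈ ⋀[R]^2 (Module.Dual R L) := ω₂.2
  have hω' : involution R L (ω₂ : Forms R L) = (1 : ℝ) • (ω₂ : Forms R L) := by
    rw [involution_of_mem_degree hω]; norm_num
  have hH : H ∈ ⋀[R]^3 (Module.Dual R L) := neg_mem (hμ.apply_mem_degree hω)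
  have hNω : endDer N (ω₂ : Forms R L) ∈ ⋀[R]^2 (Module.Dual R L) := endDer_mem_degree N hω
  have hNω' : involution R L (endDer N (ω₂ : Forms R L)) = (1 : ℝ) • endDer N (ω₂ : Forms R L) := by
    rw [involution_of_mem_degree hNω]; norm_num
  -- This ½ makes d i_N ω equal to 2ψ, as needed for {δ, ω} to be a multiple of φ.
  have hψ : ψ = (2⁻¹ : ℝ) • μ [endDer N (ω₂ : Forms R L)] := by
    have := μ.2.map_smul [] [] (2⁻¹ : ℝ) (endDer N (ω₂ : Forms R L))
    exact this
  have odd3 : ∀ {a : Forms R L}, a ∈ ⋀[R]^3 (Module.Dual R L) →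
      involution R L a = (-1 : ℝ) • a := fun ha => by
    rw [involution_of_mem_degree ha]; norm_num
  have hφ : ψ + endDer N H ∈ ⋀[R]^3 (Module.Dual R L) := by
    rw [hψ]
    exact add_mem (Submodule.smul_of_tower_mem _ _ (hμ.apply_mem_degree hNω))
      (endDer_mem_degree N hH)
  have hHp : HasParity (ofForm H) (-1) := hasParity_ofForm (Or.inr rfl) (odd3 hH)
  have hωp : HasParity ωf 1 := hasParity_ofForm (Or.inl rfl) hω'
  have hπp : HasParity πf 1 := hasParity_ofBivector π
  have hNp : HasParity (ofEnd N) 1 := hasParity_ofEnd N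
  set K : CotangentFunctions R L := ⁅πf, μ⁆ with hKdef
  set δ : CotangentFunctions R L := ⁅ofEnd N, μ⁆ + ⁅πf, ofForm H⁆ with hδdef
  set φ : CotangentFunctions R L := ofForm (ψ + endDer N H) with hφdef
  have hKp : HasParity K (-1) := hμ.hasParity_bracket π
  have hδp : HasParity δ (-1) := by
    have h1 := hNp.bracket hμ.hasParity
    have h2 := hπp.bracket hHp
    rw [one_mul] at h1 h2
    exact h1.add h2
  have hφp : HasParity φ (-1) := hasParity_ofForm (Or.inr rfl) (odd3 hφ)
  have hNH : ⁅ofEnd N, ofForm H⁆ = ofForm (endDer N H) :=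
    bracket_ofEnd_ofForm N (Or.inr rfl) (odd3 hH)
  have hμω : ⁅μ, ωf⁆ = -ofForm H := by
    rw [hμ.bracket_ofForm (Or.inl rfl) hω', ← ofForm_neg, neg_neg]
  have hπω : ⁅πf, ωf⁆ = -ofEnd N := bracket_ofBivector_ofForm π ω₂
  have hS : S = K + δ + φ := by
    change ⁅πf + ofEnd N, μ + ofForm H⁆ + ofForm ψ = K + δ + φ
    rw [bracket_add_left, bracket_add_right, bracket_add_right, hNH, hφdef, ofForm_add, hδdef]
    abel
  -- The derivation rule gives {π, {μ, ω}} + {{π, ω}, μ} = -{π, H} - {N, μ}.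
  have hKω : ⁅K, ωf⁆ = -δ := by
    rw [hKdef, bracket_bracket_even hπp hμ.hasParity hωp, hμω, hπω, bracket_neg_right,
      bracket_neg_left, hδdef]
    abel
  -- Both summands of δ contribute -i_N H: {N, μ} through {μ, ω} = -H, and {π, H} through {π, ω} =
  -- -N. The summand {N, μ} also contributes {i_N ω, μ} = -d i_N ω = -2ψ.
  have hδω : ⁅δ, ωf⁆ = (-2 : ℝ) • φ := by
    have hHω : ⁅ofForm H, ωf⁆ = 0 := bracket_ofForm_ofForm _ (Or.inl rfl) hω'
    have h1 : ⁅⁅ofEnd N, μ⁆, ωf⁆ = -ofForm (endDer N H)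
        - ofForm (μ [endDer N (ω₂ : Forms R L)]) := by
      rw [bracket_bracket_even hNp hμ.hasParity hωp, hμω, bracket_neg_right, hNH,
        bracket_ofEnd_ofForm N (Or.inl rfl) hω',
        bracket_swap_even (hasParity_ofForm (Or.inl rfl) hNω') hμ.hasParity,
        hμ.bracket_ofForm (Or.inl rfl) hNω']
      abel
    have h2 : ⁅⁅πf, ofForm H⁆, ωf⁆ = -ofForm (endDer N H) := by
      rw [bracket_bracket_even hπp hHp hωp, hHω, bracket_zero_right, hπω, bracket_neg_left, hNH,
        zero_add]
    rw [hδdef, bracket_add_left, h1, h2, hφdef, ofForm_add, hψ, ofForm_smul]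
    module
  have hφω : ⁅φ, ωf⁆ = 0 := bracket_ofForm_ofForm _ (Or.inl rfl) hω'
  have hK0 : ⁅K, K⁆ = 0 := hμ.bracket_self_of_isPoisson hπ
  have hKπ : ⁅K, πf⁆ = 0 := hμ.bracket_bracket_of_isPoisson hπ
  have i1 : ⁅μ, -πf⁆ = K := by
    rw [bracket_neg_right, hKdef, bracket_swap_even hπp hμ.hasParity]
  have i2 : ⁅K, -πf⁆ = 0 := by rw [bracket_neg_right, hKπ, neg_zero]
  have j1 : ⁅K, -ωf⁆ = δ := by rw [bracket_neg_right, hKω, neg_neg]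
  have j2 : ⁅δ, -ωf⁆ = (2 : ℝ) • φ := by rw [bracket_neg_right, hδω]; module
  have j3 : ⁅φ, -ωf⁆ = 0 := by rw [bracket_neg_right, hφω, neg_zero]
  have t1 := iterate_bracket_eq_zero (τ := -πf) (P := μ) (n := 2) (by
    simp only [Function.iterate_succ_apply, Function.iterate_zero_apply, i1, i2])
  have t2 := iterate_bracket_eq_zero (τ := -ωf) (P := K) (n := 3) (by
    simp only [Function.iterate_succ_apply, Function.iterate_zero_apply, j1, j2, bracket_smul_left,
      j3, smul_zero])
  have w1 : twist (-πf) μ - μ = K := by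
    rw [twist_eq_sum t1]
    simp only [Finset.sum_range_succ, Finset.sum_range_zero, Function.iterate_succ_apply,
      Function.iterate_zero_apply, i1, Nat.factorial, Nat.cast_one, inv_one, mul_one]
    module
  -- The terms are K, δ and ½ · 2φ, so the factorial 2! accounts for the factor in {δ, -ω} = 2φ.
  have w2 : S = twist (-ωf) K := by
    rw [twist_eq_sum t2, hS]
    simp only [Finset.sum_range_succ, Finset.sum_range_zero, Function.iterate_succ_apply,
      Function.iterate_zero_apply, j1, j2, Nat.factorial, Nat.cast_one, inv_one, mul_one]
    norm_num
    module
  refine ⟨K, δ, hμ.isKoszulHamiltonian_iff π, hK0, hμ.isBackgroundDerivation_iff π N hH, hS, ?_,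
    ⟨2, t1⟩, ?_, ?_, w1, w2⟩
  · rw [hS]
    exact bracket_self_eq_zero_of_twist hKp hδp hφp hωp hK0 hKω hδω hφω
      (bracket_ofForm_ofForm _ (Or.inr rfl) (odd3 hφ))
  · rw [w1]; exact ⟨3, t2⟩
  · rw [w1]; exact w2

end Main

end SuperCotangent

/-! ### The case of smooth functions on M and smooth sections of A. -/

theorem mainTheorem6 {n : ℕ} {M : Type*} [TopologicalSpace M] [T2Space M] [SigmaCompactSpace M]
    [ChartedSpace (EuclideanSpace ℝ (Fin n)) M] [IsManifold (𝓡 n) ∞ M]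
    {F : Type*} [NormedAddCommGroup F] [NormedSpace ℝ F] [FiniteDimensional ℝ F]
    {A : M → Type*} [TopologicalSpace (Bundle.TotalSpace F A)] [∀ x, TopologicalSpace (A x)]
    [FiberBundle F A] [∀ x, AddCommGroup (A x)] [∀ x, Module ℝ (A x)] [VectorBundle ℝ F A]
    [ContMDiffVectorBundle ∞ F A (𝓡 n)]
    -- a Lie algebroid structure on `A`, and the function `μ` on `T^*ΠA` that corresponds to it
    (𝓐 : LieAlgebroid C^∞⟮𝓡 n, M; ℝ⟯ Cₛ^∞⟮𝓡 n; F, A⟯)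
    (μ : CotangentFunctions C^∞⟮𝓡 n, M; ℝ⟯ Cₛ^∞⟮𝓡 n; F, A⟯) (hμ : 𝓐.IsHamiltonian μ)
    -- a Poisson bivector and a two-form
    (π : ⋀[C^∞⟮𝓡 n, M; ℝ⟯]^2 Cₛ^∞⟮𝓡 n; F, A⟯) (hπ : 𝓐.IsPoisson π)
    (ω₂ : ⋀[C^∞⟮𝓡 n, M; ℝ⟯]^2 (Module.Dual C^∞⟮𝓡 n, M; ℝ⟯ Cₛ^∞⟮𝓡 n; F, A⟯)) :
    let N := sharp π ∘ₗ flat ω₂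
    let ψ := μ [omegaN ω₂ N]
    let H := -μ [(ω₂ : Forms C^∞⟮𝓡 n, M; ℝ⟯ Cₛ^∞⟮𝓡 n; F, A⟯)]
    let S := inducedStructure μ π N ψ H
    let πf := ofBivector π
    let ωf := ofForm (ω₂ : Forms C^∞⟮𝓡 n, M; ℝ⟯ Cₛ^∞⟮𝓡 n; F, A⟯)
    ∃ μπ δ : CotangentFunctions C^∞⟮𝓡 n, M; ℝ⟯ Cₛ^∞⟮𝓡 n; F, A⟯,
      -- `μπ` is the Lie algebroid structure on `A^*` defined by `π`
      (∀ P, IsKoszulHamiltonian 𝓐 μ π P ↔ P = μπ) ∧ ⁅μπ, μπ⁆ = 0 ∧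
      -- `S` is the Lie quasi-bialgebroid structure given by `μπ`, the derivation `δ = d_N^H`
      -- and the three-form `ψ + i_N H`
      (∀ P, IsBackgroundDerivation μ π N H P ↔ P = δ) ∧
      S = μπ + δ + ofForm (ψ + endDer N H) ∧ ⁅S, S⁆ = 0 ∧
      -- the exponential series below are finite sums
      TwistTerminates (-πf) μ ∧ TwistTerminates (-ωf) (twist (-πf) μ - μ) ∧
      S = twist (-ωf) (twist (-πf) μ - μ) ∧
      twist (-πf) μ - μ = μπ ∧ S = twist (-ωf) μπ := by
  exact twist_poisson_two_form 𝓐 μ hμ π hπ ω₂
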